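/- For $r>0$ let $q=e^{-\pi\sqrt r}$, let $K(k)=\int_0^{\pi/2}\frac{d\theta}{\sqrt{1-k^2\sin^2\theta}}$, let $k_r\in(0,1)$ be the singular modulus, i.e. the unique $k\in(0,1)$ with $K(\sqrt{1-k^2})/K(k)=\sqrt r$, and put $K=K(k_r)$, $K'=K(\sqrt{1-k_r^2})$. Consider the series $$\mathrm{cd}_1(q,u)=\frac{2\pi}{Kk_r}\sum_{n=0}^{\infty}\frac{(-1)^nq^{n+1/2}\cos\left((2n+3)\frac{\pi u}{2K}\right)}{1-q^{2n+1}},$$ which converges for $|\operatorname{Im}u|<K'$. Its sum has a unique meromorphic continuation to $\mathbb C$, again denoted $\mathrm{cd}_1(q,\cdot)$; this continuation is analytic at $u=iK'$, and $$\mathrm{cd}_1(q,iK')=\frac{1}{q\,k_r}-\frac{\sinh(\pi\sqrt r)}{k_r}\left(1-\frac{\pi}{2K}\right).$$ -/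

import Mathlib

open Real

/-- The complete elliptic integral of the first kind `K(k)`, as a function of the modulus `k`. -/
noncomputable def ellipticK (k : ℝ) : ℝ :=
  ∫ θ in (0 : ℝ)..(π / 2), 1 / √(1 - k ^ 2 * sin θ ^ 2)

/-- The complementary modulus `k' = √(1 - k ^ 2)`. -/
noncomputable def complementaryModulus (k : ℝ) : ℝ := √(1 - k ^ 2)

theorem complementaryModulus_mem {k : ℝ} (hk : k ∈ Set.Ioo (0 : ℝ) 1) :
    complementaryModulus k ∈ Set.Ioo (0 : ℝ) 1 := by
  obtain ⟨h0, h1⟩ := hk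
  refine ⟨Real.sqrt_pos.2 (by nlinarith), ?_⟩
  rw [complementaryModulus, Real.sqrt_lt' one_pos]
  nlinarith

theorem complementaryModulus_invol {k : ℝ} (hk : k ∈ Set.Ioo (0 : ℝ) 1) :
    complementaryModulus (complementaryModulus k) = k := by
  obtain ⟨h0, h1⟩ := hk
  rw [complementaryModulus, complementaryModulus, Real.sq_sqrt (by nlinarith)]
  rw [sub_sub_cancel, Real.sqrt_sq h0.le]

theorem complementaryModulus_lt {a b : ℝ} (ha : a ∈ Set.Ioo (0 : ℝ) 1) (hb : b ∈ Set.Ioo (0 : ℝ) 1)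
    (h : a < b) : complementaryModulus b < complementaryModulus a := by
  obtain ⟨h0, h1⟩ := ha
  obtain ⟨h2, h3⟩ := hb
  exact Real.sqrt_lt_sqrt (by nlinarith) (by nlinarith)

theorem ellipticK_radicand_ge {k c : ℝ} (hk : |k| ≤ c) (θ : ℝ) :
    1 - c ^ 2 ≤ 1 - k ^ 2 * sin θ ^ 2 := by
  have h1 : k ^ 2 ≤ c ^ 2 := sq_le_sq' (by linarith [abs_le.1 hk]) (abs_le.1 hk).2
  have h2 : sin θ ^ 2 ≤ 1 := Real.sin_sq_le_one θ
  nlinarith [sq_nonneg k, sq_nonneg (sin θ)]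

theorem ellipticK_integrand_continuous {k : ℝ} (hk : k ∈ Set.Ioo (0 : ℝ) 1) :
    Continuous (fun θ : ℝ => 1 / √(1 - k ^ 2 * sin θ ^ 2)) := by
  refine Continuous.div continuous_const (by fun_prop) (fun θ => ?_)
  have := ellipticK_radicand_ge (k := k) (c := k) (by rw [abs_of_pos hk.1]) θ
  exact (Real.sqrt_pos.2 (by nlinarith [hk.1, hk.2])).ne'

theorem ellipticK_pos {k : ℝ} (hk : k ∈ Set.Ioo (0 : ℝ) 1) : 0 < ellipticK k := by
  refine intervalIntegral.intervalIntegral_pos_of_pos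
    ((ellipticK_integrand_continuous hk).intervalIntegrable _ _) (fun θ => ?_) (by positivity)
  have := ellipticK_radicand_ge (k := k) (c := k) (by rw [abs_of_pos hk.1]) θ
  exact one_div_pos.2 (Real.sqrt_pos.2 (by nlinarith [hk.1, hk.2]))

theorem ellipticK_lt {a b : ℝ} (ha : a ∈ Set.Ioo (0 : ℝ) 1) (hb : b ∈ Set.Ioo (0 : ℝ) 1)
    (h : a < b) : ellipticK a < ellipticK b := by
  have hpos : ∀ θ, 0 < 1 - b ^ 2 * sin θ ^ 2 := fun θ => by
    have := ellipticK_radicand_ge (k := b) (c := b) (by rw [abs_of_pos hb.1]) θ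
    nlinarith [hb.1, hb.2]
  have hab : a ^ 2 < b ^ 2 := by nlinarith [ha.1]
  refine intervalIntegral.integral_lt_integral_of_continuousOn_of_le_of_exists_lt (by positivity)
    (ellipticK_integrand_continuous ha).continuousOn
    (ellipticK_integrand_continuous hb).continuousOn (fun θ _ => ?_)
    ⟨π / 2, ⟨by positivity, le_rfl⟩, ?_⟩
  · refine one_div_le_one_div_of_le (Real.sqrt_pos.2 (hpos θ)) (Real.sqrt_le_sqrt ?_)
    nlinarith [sq_nonneg (sin θ)]
  · refine one_div_lt_one_div_of_lt (Real.sqrt_pos.2 (hpos _)) (Real.sqrt_lt_sqrt (hpos _).le ?_)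
    rw [Real.sin_pi_div_two]
    nlinarith

theorem ellipticK_continuousOn : ContinuousOn ellipticK (Set.Ioo (0 : ℝ) 1) := by
  intro k0 hk0
  refine ContinuousAt.continuousWithinAt ?_
  obtain ⟨c, hc0, hc1⟩ := exists_between hk0.2
  have hcpos : 0 < c := hk0.1.trans hc0
  have hnear : ∀ᶠ k in nhds k0, k ∈ Set.Ioo 0 c := Ioo_mem_nhds hk0.1 hc0
  refine intervalIntegral.continuousAt_of_dominated_interval (bound := fun _ => 1 / √(1 - c ^ 2))
    ?_ ?_ (by simp) ?_
  · filter_upwards [hnear] with k hk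
    exact (ellipticK_integrand_continuous ⟨hk.1, hk.2.trans hc1⟩).aestronglyMeasurable
  · filter_upwards [hnear] with k hk
    refine Filter.Eventually.of_forall (fun θ _ => ?_)
    rw [Real.norm_of_nonneg (by positivity)]
    exact one_div_le_one_div_of_le (Real.sqrt_pos.2 (by nlinarith))
      (Real.sqrt_le_sqrt (ellipticK_radicand_ge (by rw [abs_of_pos hk.1]; exact hk.2.le) θ))
  · refine Filter.Eventually.of_forall (fun θ _ => ?_)
    refine ContinuousAt.div continuousAt_const (by fun_prop) ?_
    have := ellipticK_radicand_ge (k := k0) (c := c) (by rw [abs_of_pos hk0.1]; exact hc0.le) θ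
    exact (Real.sqrt_pos.2 (by nlinarith)).ne'

theorem ellipticK_le_pi {k : ℝ} (hk : k ∈ Set.Ioo (0 : ℝ) 1) (h : k ≤ 1 / 2) :
    ellipticK k ≤ π := by
  have h1 : ellipticK k ≤ ∫ _ in (0 : ℝ)..(π / 2), (2 : ℝ) := by
    refine intervalIntegral.integral_mono_on (by positivity)
      ((ellipticK_integrand_continuous hk).intervalIntegrable _ _) (by simp) (fun θ _ => ?_)
    have h2 := ellipticK_radicand_ge (k := k) (c := 1 / 2) (by rwa [abs_of_pos hk.1]) θ
    have h3 : (1 : ℝ) / 2 ≤ √(1 - k ^ 2 * sin θ ^ 2) := Real.le_sqrt_of_sq_le (by linarith)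
    calc 1 / √(1 - k ^ 2 * sin θ ^ 2) ≤ 1 / (1 / 2) :=
          one_div_le_one_div_of_le (by norm_num) h3
      _ = 2 := by norm_num
  simpa using h1

theorem ellipticK_complementary_ge {k : ℝ} (hk : k ∈ Set.Ioo (0 : ℝ) 1) :
    -Real.log k ≤ ellipticK (complementaryModulus k) := by
  have hk' := complementaryModulus_mem hk
  have hint : ∫ θ in (0 : ℝ)..(π / 2), 1 / (π / 2 + k - θ) = Real.log ((π / 2 + k) / k) := by
    rw [intervalIntegral.integral_comp_sub_left (fun x : ℝ => 1 / x) (π / 2 + k)]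
    rw [integral_one_div_of_pos (by linarith [hk.1]) (by linarith [hk.1, Real.pi_pos])]
    ring_nf
  have hden : ∀ θ ∈ Set.Icc (0 : ℝ) (π / 2), 0 < π / 2 + k - θ := fun θ hθ => by
    linarith [hθ.2, hk.1]
  have h1 : ∫ θ in (0 : ℝ)..(π / 2), 1 / (π / 2 + k - θ) ≤
      ellipticK (complementaryModulus k) := by
    refine intervalIntegral.integral_mono_on (by positivity) ?_
      ((ellipticK_integrand_continuous hk').intervalIntegrable _ _) (fun θ hθ => ?_)
    · refine ContinuousOn.intervalIntegrable ?_
      rw [Set.uIcc_of_le (by positivity)]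
      exact ContinuousOn.div continuousOn_const (by fun_prop) (fun θ hθ => (hden θ hθ).ne')
    · have h2 := ellipticK_radicand_ge (k := complementaryModulus k)
        (c := complementaryModulus k) (by rw [abs_of_pos hk'.1]) θ
      have hlt : 0 < 1 - complementaryModulus k ^ 2 * sin θ ^ 2 := by nlinarith [hk'.1, hk'.2]
      refine one_div_le_one_div_of_le (Real.sqrt_pos.2 hlt) ?_
      rw [Real.sqrt_le_left (hden θ hθ).le]
      have hsq : complementaryModulus k ^ 2 = 1 - k ^ 2 :=
        Real.sq_sqrt (by nlinarith [hk.1, hk.2])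
      have hcos : cos θ ≤ π / 2 - θ := by
        rw [← Real.sin_pi_div_two_sub]
        exact Real.sin_le (by linarith [hθ.2])
      have hcos0 : 0 ≤ cos θ := Real.cos_nonneg_of_mem_Icc ⟨by linarith [hθ.1, Real.pi_pos], hθ.2⟩
      have hs := Real.sin_sq_add_cos_sq θ
      have hs1 : sin θ ^ 2 ≤ 1 := Real.sin_sq_le_one θ
      have hk2 : k ^ 2 * sin θ ^ 2 ≤ k ^ 2 := by nlinarith [sq_nonneg k]
      have hx : 0 ≤ π / 2 - θ := by linarith [hθ.2]
      have hc2 : cos θ ^ 2 ≤ (π / 2 - θ) ^ 2 := by nlinarith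
      rw [hsq]
      nlinarith [mul_nonneg hx hk.1.le]
  rw [hint] at h1
  refine le_trans ?_ h1
  rw [← Real.log_inv]
  refine Real.log_le_log (inv_pos.2 hk.1) ?_
  rw [← one_div]
  refine div_le_div_of_nonneg_right ?_ hk.1.le
  linarith [Real.pi_gt_three, hk.1]

theorem exists_ratio_ge (s : ℝ) :
    ∃ k ∈ Set.Ioo (0 : ℝ) 1, s * ellipticK k ≤ ellipticK (complementaryModulus k) := by
  have hk : min (1 / 2) (Real.exp (-(|s| * π))) ∈ Set.Ioo (0 : ℝ) 1 :=
    ⟨lt_min (by norm_num) (Real.exp_pos _), (min_le_left _ _).trans_lt (by norm_num)⟩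
  refine ⟨_, hk, ?_⟩
  have h1 := ellipticK_le_pi hk (min_le_left _ _)
  have h2 := ellipticK_complementary_ge hk
  have h3 := Real.log_le_log hk.1 (min_le_right (1 / 2) (Real.exp (-(|s| * π))))
  rw [Real.log_exp] at h3
  have h4 := ellipticK_pos hk
  nlinarith [abs_nonneg s, le_abs_self s]

/-- For every `r > 0` exactly one modulus `0 < k < 1` satisfies `K(k') / K(k) = √r`. -/
theorem existsUnique_singularModulus {r : ℝ} (hr : 0 < r) :
    ∃! k : ℝ, k ∈ Set.Ioo (0 : ℝ) 1 ∧ ellipticK (complementaryModulus k) / ellipticK k = √r := by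
  have hs : 0 < √r := Real.sqrt_pos.2 hr
  set h : ℝ → ℝ := fun k => ellipticK (complementaryModulus k) - √r * ellipticK k with hh
  have hcont : ContinuousOn h (Set.Ioo (0 : ℝ) 1) := by
    refine ContinuousOn.sub (ellipticK_continuousOn.comp ?_ fun k hk => complementaryModulus_mem hk)
      (continuousOn_const.mul ellipticK_continuousOn)
    unfold complementaryModulus
    fun_prop
  obtain ⟨a, ha, ha'⟩ := exists_ratio_ge (√r)
  obtain ⟨b, hb, hb'⟩ := exists_ratio_ge (1 / √r)
  have hb2 := complementaryModulus_mem hb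
  have hmem : (0 : ℝ) ∈ Set.Icc (h (complementaryModulus b)) (h a) := by
    refine ⟨?_, by simp only [hh]; linarith⟩
    simp only [hh, complementaryModulus_invol hb]
    rw [one_div_mul_eq_div, div_le_iff₀ hs] at hb'
    linarith
  obtain ⟨k, hk, hk0⟩ := isPreconnected_Ioo.intermediate_value hb2 ha hcont hmem
  have key : ∀ x ∈ Set.Ioo (0 : ℝ) 1,
      ellipticK (complementaryModulus x) / ellipticK x = √r ↔ h x = 0 := fun x hx => by
    rw [div_eq_iff (ellipticK_pos hx).ne']
    simp only [hh]
    exact sub_eq_zero.symm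
  have anti : ∀ x ∈ Set.Ioo (0 : ℝ) 1, ∀ y ∈ Set.Ioo (0 : ℝ) 1, x < y → h y < h x := by
    intro x hx y hy hxy
    have h1 := ellipticK_lt hx hy hxy
    have h2 := ellipticK_lt (complementaryModulus_mem hy) (complementaryModulus_mem hx)
      (complementaryModulus_lt hx hy hxy)
    simp only [hh]
    nlinarith
  refine ⟨k, ⟨hk, (key k hk).2 hk0⟩, fun y ⟨hy, hy'⟩ => ?_⟩
  rw [key y hy] at hy'
  rcases lt_trichotomy y k with hlt | heq | hgt
  · linarith [anti y hy k hk hlt]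
  · exact heq
  · linarith [anti k hk y hy hgt]

open Classical in
/-- The singular modulus `k_r`: for `r > 0`, the unique `0 < k < 1` with `K(k') / K(k) = √r`
(and `0` for the irrelevant values `r ≤ 0`). -/
noncomputable def singularModulus (r : ℝ) : ℝ :=
  if hr : 0 < r then (existsUnique_singularModulus hr).choose else 0

theorem singularModulus_spec {r : ℝ} (hr : 0 < r) :
    singularModulus r ∈ Set.Ioo (0 : ℝ) 1 ∧
      ellipticK (complementaryModulus (singularModulus r)) / ellipticK (singularModulus r) = √r := by
  rw [singularModulus, dif_pos hr]
  exact (existsUnique_singularModulus hr).choose_spec.1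

/-- The nome `q = exp (-π √r)`. -/
noncomputable def nome (r : ℝ) : ℝ := Real.exp (-(π * √r))

/-- The quarter period `K = K(k_r)`. -/
noncomputable def quarterPeriod (r : ℝ) : ℝ := ellipticK (singularModulus r)

/-- The quarter period `K' = K(k_r')`. -/
noncomputable def quarterPeriod' (r : ℝ) : ℝ :=
  ellipticK (complementaryModulus (singularModulus r))

/-- The `n`-th term (prefactor included) of the series
`cd₁(q, u) = 2π / (K k_r) * ∑ (-1)^n q^(n+1/2) cos((2n+3) π u / (2K)) / (1 - q^(2n+1))`. -/
noncomputable def cd₁Term (r : ℝ) (u : ℂ) (n : ℕ) : ℂ :=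
  (2 * π / (quarterPeriod r * singularModulus r) : ℝ) *
    ((-1) ^ n * (nome r ^ ((n : ℝ) + 1 / 2) : ℝ) *
      Complex.cos ((2 * n + 3) * (π / (2 * quarterPeriod r)) * u) /
        (1 - (nome r : ℂ) ^ (2 * n + 1)))

/-- `F` is the function `cd₁(q, ·)`, `q = exp (-π √r)`, on the complex plane: a meromorphic
function on `ℂ` which on the strip `|Im u| < K'`, where the defining series converges, is the
sum of that series. At points off the strip, the value is thus that of the analytic
continuation of the series. `MeromorphicNFOn` only excludes changing the value at isolated
points: `F` has the right value wherever its singularity is removable, and the conventional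
value `0` at its poles. -/
def IsCd₁ (r : ℝ) (F : ℂ → ℂ) : Prop :=
  MeromorphicNFOn F Set.univ ∧
    ∀ u : ℂ, |u.im| < quarterPeriod' r → HasSum (cd₁Term r u) (F u)

/-!
Let `q = exp (-π s)` with `s = √r`, and write `θ₃`, `θ₄` for the theta constants at `q`.

**Continuation.** With `w = exp (i π u / (2 K))`, expanding `1 / (1 - q ^ (2 n + 1))` as a geometric
series and exchanging the summations turns the series of `cd₁` into
`π √q / (K k) * (w ^ 3 H(w ^ 2) + w ^ (-3) H(w ^ (-2)))` with
`H(x) = ∑ q ^ m / (1 + q ^ (2 m + 1) x)` (`hasSum_poleSeries`, `hasSum_cd₁Term`). Near any point of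
`ℂ` all but finitely many terms of `H` form a uniformly convergent series of analytic functions, so
this is meromorphic on `ℂ`; its normal form is the continuation, which is unique by the identity
theorem.

**Value.** At `u = i K'` one has `w ^ 2 = q`, no denominator vanishes, and `H(q)` and `H(1 / q)` are
both expressed by the Lambert series `S = ∑ 1 / cosh (π s n)` over `n ∈ ℤ`. The theorem therefore
reduces to `S = 2 K / π`, which follows from the two facts below.

**`S = θ₃²`** (`sechSum_eq`). Up to the factor `q ^ (n ^ 2)`, the Fourier coefficients of the
product of the theta function `∑ (-1) ^ m q ^ (m ^ 2) z ^ m` with `∑ z ^ j / cosh (π s j)` do not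
depend on `n`: the difference of two consecutive ones is a series whose terms cancel in pairs.
Evaluating at `z = 1` and `z = -1` gives `θ₄ S = C θ₃` and `θ₃ S' = C θ₄` with the same `C`, where
`S'` is the alternating version of `S`. As `S(s) + S'(s) = 2 S(2 s)` and
`θ₃(s)² + θ₄(s)² = 2 θ₃(2 s)²`, the ratio `S / θ₃²` is invariant under `s ↦ 2 s`, and it tends to `1`
as `s → ∞`; hence it is `1`.

**`2 K / π = θ₃²`** (`quarterPeriod_eq`). Gauss's integral is invariant under replacing its two
parameters by their arithmetic and geometric means (`gaussIntegral_agm`), and `s ↦ 2 s` does exactly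
this to `θ₃²` and `θ₄²`, so the integral at `(θ₃², θ₄²)` equals its limit `π / 2`. Consequently the
modulus with complementary modulus `θ₄² / θ₃²` has `K = π θ₃² / 2`. Poisson summation gives
`θ₃(1/s)² = s θ₃(s)²`, and with the quartic identity it shows that `s ↦ 1/s` exchanges this modulus
with its complement, so that `K' / K = s` and the modulus is the singular one
(`singularModulus_eq`).
-/

/-! ### Theta constants -/

/-- The theta constant `θ₃ = ∑ q ^ (n ^ 2)` over `n ∈ ℤ`, at the nome `q = exp (-π s)`. -/
noncomputable def theta3 (s : ℝ) : ℝ := ∑' n : ℤ, Real.exp (-π * s * (n : ℝ) ^ 2)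

/-- The theta constant `θ₄ = ∑ (-1) ^ n q ^ (n ^ 2)` over `n ∈ ℤ`, at the nome
`q = exp (-π s)`. -/
noncomputable def theta4 (s : ℝ) : ℝ :=
  ∑' n : ℤ, (-1 : ℝ) ^ n * Real.exp (-π * s * (n : ℝ) ^ 2)

theorem summable_exp_quadratic {s : ℝ} (hs : 0 < s) (b : ℝ) :
    Summable fun n : ℤ => Real.exp (-π * s * ((n : ℝ) ^ 2 + b * n)) := by
  have h := (summable_jacobiTheta₂_term_iff (Complex.I * (s * b / 2 : ℝ)) (Complex.I * s)).2
    (by simpa using hs)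
  refine h.norm.congr fun n => ?_
  rw [norm_jacobiTheta₂_term]
  congr 1
  simp
  ring

theorem summable_exp_sq {s : ℝ} (hs : 0 < s) :
    Summable fun n : ℤ => Real.exp (-π * s * (n : ℝ) ^ 2) := by
  simpa using summable_exp_quadratic hs 0

theorem summable_alternating {f : ℤ → ℝ} (hf : Summable fun n => |f n|) :
    Summable fun n : ℤ => (-1 : ℝ) ^ n * f n := by
  refine Summable.of_abs (hf.congr fun n => ?_)
  rw [abs_mul, abs_neg_one_zpow, one_mul]

theorem summable_alternating_exp_sq {s : ℝ} (hs : 0 < s) :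
    Summable fun n : ℤ => (-1 : ℝ) ^ n * Real.exp (-π * s * (n : ℝ) ^ 2) :=
  summable_alternating (summable_exp_sq hs).abs

theorem theta3_pos {s : ℝ} (hs : 0 < s) : 0 < theta3 s :=
  (summable_exp_sq hs).tsum_pos (fun _ => (Real.exp_pos _).le) 0 (Real.exp_pos _)

/-- Adding its alternating version to a series over `ℤ` keeps twice the even terms. -/
theorem tsum_add_tsum_alternating {f : ℤ → ℝ} (hf : Summable f) :
    ∑' n, f n + ∑' n : ℤ, (-1 : ℝ) ^ n * f n = 2 * ∑' n : ℤ, f (2 * n) := by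
  rw [← hf.tsum_add (summable_alternating hf.abs), ← tsum_mul_left]
  have hinj : Function.Injective fun n : ℤ => 2 * n := fun a b h => by
    simpa using h
  rw [← hinj.tsum_eq (f := fun n : ℤ => f n + (-1 : ℝ) ^ n * f n)]
  · refine tsum_congr fun n => ?_
    rw [(even_two_mul n).neg_one_zpow]
    ring
  · intro n hn
    rcases Int.even_or_odd n with h | h
    · obtain ⟨m, hm⟩ := h
      exact ⟨m, by simp only; omega⟩
    · exact absurd (by simp [h.neg_one_zpow]) hn

theorem theta3_add_theta4 {s : ℝ} (hs : 0 < s) :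
    theta3 s + theta4 s = 2 * theta3 (4 * s) := by
  rw [theta3, theta4, tsum_add_tsum_alternating (summable_exp_sq hs), theta3]
  congr 1
  refine tsum_congr fun n => ?_
  congr 1
  push_cast
  ring

/-- A series over `ℤ × ℤ` supported on the pairs of equal parity, reindexed by
`(a, b) ↦ (a + b, a - b)`. -/
theorem tsum_same_parity (f : ℤ × ℤ → ℝ) (hf : ∀ m n : ℤ, Odd (m + n) → f (m, n) = 0) :
    ∑' p, f p = ∑' p : ℤ × ℤ, f (p.1 + p.2, p.1 - p.2) := by
  have hinj : Function.Injective fun p : ℤ × ℤ => (p.1 + p.2, p.1 - p.2) := by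
    rintro ⟨a, b⟩ ⟨c, d⟩ h
    simp only [Prod.mk.injEq] at h ⊢
    omega
  refine (hinj.tsum_eq ?_).symm
  rintro ⟨m, n⟩ hmn
  rcases Int.even_or_odd (m + n) with h | h
  · obtain ⟨c, hc⟩ := h
    exact ⟨(c, m - c), by simp only [Prod.mk.injEq]; omega⟩
  · exact absurd (hf m n h) hmn

theorem theta3_mul_self {s : ℝ} (hs : 0 < s) :
    theta3 s ^ 2 =
      ∑' p : ℤ × ℤ, Real.exp (-π * s * (p.1 : ℝ) ^ 2) * Real.exp (-π * s * (p.2 : ℝ) ^ 2) := by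
  rw [sq, theta3]
  exact tsum_mul_tsum_of_summable_norm (summable_exp_sq hs).norm (summable_exp_sq hs).norm

theorem theta4_mul_self {s : ℝ} (hs : 0 < s) :
    theta4 s ^ 2 = ∑' p : ℤ × ℤ, ((-1 : ℝ) ^ p.1 * Real.exp (-π * s * (p.1 : ℝ) ^ 2)) *
      ((-1 : ℝ) ^ p.2 * Real.exp (-π * s * (p.2 : ℝ) ^ 2)) := by
  rw [sq, theta4]
  exact tsum_mul_tsum_of_summable_norm (summable_alternating_exp_sq hs).norm
    (summable_alternating_exp_sq hs).norm

theorem exp_sq_rotate (s : ℝ) (a b : ℤ) :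
    Real.exp (-π * s * ((a + b : ℤ) : ℝ) ^ 2) * Real.exp (-π * s * ((a - b : ℤ) : ℝ) ^ 2) =
      Real.exp (-π * (2 * s) * (a : ℝ) ^ 2) * Real.exp (-π * (2 * s) * (b : ℝ) ^ 2) := by
  rw [← Real.exp_add, ← Real.exp_add]
  congr 1
  push_cast
  ring

theorem theta3_sq_add_theta4_sq {s : ℝ} (hs : 0 < s) :
    theta3 s ^ 2 + theta4 s ^ 2 = 2 * theta3 (2 * s) ^ 2 := by
  have h3 := summable_mul_of_summable_norm (summable_exp_sq hs).norm (summable_exp_sq hs).norm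
  have h4 := summable_mul_of_summable_norm (summable_alternating_exp_sq hs).norm
    (summable_alternating_exp_sq hs).norm
  rw [theta3_mul_self hs, theta4_mul_self hs, theta3_mul_self (by positivity), ← h3.tsum_add h4,
    ← tsum_mul_left, tsum_same_parity]
  · refine tsum_congr fun p => ?_
    have h := exp_sq_rotate s p.1 p.2
    have hs : (-1 : ℝ) ^ (p.1 + p.2) * (-1 : ℝ) ^ (p.1 - p.2) = 1 := by
      rw [← zpow_add₀ (by norm_num)]
      exact Even.neg_one_zpow ⟨p.1, by ring⟩
    rw [← h]
    linear_combination (Real.exp (-π * s * ((p.1 + p.2 : ℤ) : ℝ) ^ 2) *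
      Real.exp (-π * s * ((p.1 - p.2 : ℤ) : ℝ) ^ 2)) * hs
  · intro m n h
    have hs : (-1 : ℝ) ^ m * (-1 : ℝ) ^ n = -1 := by
      rw [← zpow_add₀ (by norm_num)]
      exact h.neg_one_zpow
    linear_combination (Real.exp (-π * s * (m : ℝ) ^ 2) * Real.exp (-π * s * (n : ℝ) ^ 2)) * hs

theorem theta3_mul_theta4 {s : ℝ} (hs : 0 < s) :
    theta3 s * theta4 s = theta4 (2 * s) ^ 2 := by
  have h34 := summable_mul_of_summable_norm (summable_exp_sq hs).norm
    (summable_alternating_exp_sq hs).norm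
  have h43 := summable_mul_of_summable_norm (summable_alternating_exp_sq hs).norm
    (summable_exp_sq hs).norm
  -- Averaging the two orders of multiplication makes the terms with `m + n` odd cancel.
  have key : 2 * (theta3 s * theta4 s) = 2 * theta4 (2 * s) ^ 2 := by
    rw [two_mul]
    nth_rw 2 [mul_comm]
    have e1 : theta3 s * theta4 s = _ := tsum_mul_tsum_of_summable_norm (summable_exp_sq hs).norm
      (summable_alternating_exp_sq hs).norm
    have e2 : theta4 s * theta3 s = _ := tsum_mul_tsum_of_summable_norm
      (summable_alternating_exp_sq hs).norm (summable_exp_sq hs).norm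
    rw [e1, e2, theta4_mul_self (by positivity), ← h34.tsum_add h43, ← tsum_mul_left,
      tsum_same_parity]
    · refine tsum_congr fun p => ?_
      have h := exp_sq_rotate s p.1 p.2
      have hp : (-1 : ℝ) ^ (p.1 + p.2) = (-1 : ℝ) ^ p.1 * (-1 : ℝ) ^ p.2 :=
        zpow_add₀ (by norm_num) _ _
      have hm : (-1 : ℝ) ^ (p.1 - p.2) = (-1 : ℝ) ^ p.1 * (-1 : ℝ) ^ p.2 := by
        rw [← zpow_add₀ (by norm_num), show p.1 - p.2 = p.1 + p.2 + 2 * (-p.2) by ring,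
          zpow_add₀ (by norm_num), (even_two_mul (-p.2)).neg_one_zpow, mul_one]
      simp only [hp, hm]
      linear_combination 2 * ((-1 : ℝ) ^ p.1 * (-1 : ℝ) ^ p.2) * h
    · intro m n h
      have hs : (-1 : ℝ) ^ m + (-1 : ℝ) ^ n = 0 := by
        rcases Int.even_or_odd m with hm | hm
        · have hn : Odd n := by rw [Int.odd_add'] at h; exact (h.2 hm)
          rw [hm.neg_one_zpow, hn.neg_one_zpow]; norm_num
        · have hn : Even n := by rw [Int.odd_add] at h; exact (h.1 hm)
          rw [hm.neg_one_zpow, hn.neg_one_zpow]; norm_num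
      linear_combination (Real.exp (-π * s * (m : ℝ) ^ 2) * Real.exp (-π * s * (n : ℝ) ^ 2)) * hs
  linarith

/-- The modular transformation of `θ₃`, from Poisson summation. -/
theorem theta3_inv {s : ℝ} (hs : 0 < s) : theta3 (1 / s) = √s * theta3 s := by
  have h := Real.tsum_exp_neg_mul_int_sq hs
  rw [theta3, theta3, h, Real.sqrt_eq_rpow, ← mul_assoc, mul_one_div_cancel (by positivity),
    one_mul]
  refine tsum_congr fun n => ?_
  congr 1
  ring

theorem tendsto_exp_sq {n : ℤ} :
    Filter.Tendsto (fun s : ℝ => Real.exp (-π * s * (n : ℝ) ^ 2)) Filter.atTop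
      (nhds (if n = 0 then 1 else 0)) := by
  split_ifs with h
  · simp [h]
  · have hn : 0 < π * (n : ℝ) ^ 2 := by positivity
    refine (Real.tendsto_exp_neg_atTop_nhds_zero.comp
      (Filter.tendsto_id.const_mul_atTop hn)).congr fun s => ?_
    simp only [Function.comp, id]
    congr 1
    ring

/-- A family of series over `ℤ`, dominated from `s = 1` on, whose zeroth term tends to `1` and
whose other terms tend to `0` as `s → ∞`, has sum tending to `1`. -/
theorem tendsto_tsum_one {f : ℝ → ℤ → ℝ} {b : ℤ → ℝ} (hb : Summable b)
    (hfb : ∀ s, 1 ≤ s → ∀ n, |f s n| ≤ b n)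
    (hf : ∀ n, Filter.Tendsto (fun s => f s n) Filter.atTop (nhds (if n = 0 then 1 else 0))) :
    Filter.Tendsto (fun s => ∑' n, f s n) Filter.atTop (nhds 1) := by
  have h := tendsto_tsum_of_dominated_convergence (bound := b) hb hf
    ((Filter.eventually_ge_atTop 1).mono fun s hs n => hfb s hs n)
  simpa using h

theorem exp_sq_le {s : ℝ} (hs : 1 ≤ s) (n : ℤ) :
    Real.exp (-π * s * (n : ℝ) ^ 2) ≤ Real.exp (-π * 1 * (n : ℝ) ^ 2) := by
  rw [Real.exp_le_exp]
  have : 0 ≤ π * (n : ℝ) ^ 2 := by positivity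
  nlinarith

theorem tendsto_theta3 : Filter.Tendsto theta3 Filter.atTop (nhds 1) := by
  refine tendsto_tsum_one (summable_exp_sq one_pos) (fun s hs n => ?_) fun n => tendsto_exp_sq
  rw [abs_of_pos (Real.exp_pos _)]
  exact exp_sq_le hs n

theorem tendsto_theta4 : Filter.Tendsto theta4 Filter.atTop (nhds 1) := by
  refine tendsto_tsum_one (summable_exp_sq one_pos) (fun s hs n => ?_) fun n => ?_
  · rw [abs_mul, abs_neg_one_zpow, one_mul, abs_of_pos (Real.exp_pos _)]
    exact exp_sq_le hs n
  · have h := (tendsto_exp_sq (n := n)).const_mul ((-1 : ℝ) ^ n)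
    convert h using 2
    split_ifs with hn <;> simp [hn]

/-- A function on `(0, ∞)` invariant under `s ↦ 2 s` equals its limit at infinity. -/
theorem eq_of_doubling {f : ℝ → ℝ} {L : ℝ} (hf : ∀ s, 0 < s → f (2 * s) = f s)
    (hL : Filter.Tendsto f Filter.atTop (nhds L)) {s : ℝ} (hs : 0 < s) : f s = L := by
  have h1 : ∀ n : ℕ, f (2 ^ n * s) = f s := fun n => by
    induction n with
    | zero => simp
    | succ n ih => rw [pow_succ', mul_assoc, hf _ (by positivity), ih]
  have h2 : Filter.Tendsto (fun n : ℕ => (2 : ℝ) ^ n * s) Filter.atTop Filter.atTop :=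
    (tendsto_pow_atTop_atTop_of_one_lt one_lt_two).atTop_mul_const hs
  have h3 := hL.comp h2
  simp only [Function.comp_def, h1] at h3
  exact tendsto_nhds_unique tendsto_const_nhds h3

theorem theta4_ne_zero {s : ℝ} (hs : 0 < s) : theta4 s ≠ 0 := by
  intro h0
  have h1 : ∀ n : ℕ, theta4 (2 ^ n * s) = 0 := fun n => by
    induction n with
    | zero => simpa using h0
    | succ n ih =>
      have h := theta3_mul_theta4 (s := 2 ^ n * s) (by positivity)
      rw [ih, mul_zero] at h
      rw [pow_succ', mul_assoc]
      exact pow_eq_zero_iff two_ne_zero |>.1 h.symm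
  have h2 : Filter.Tendsto (fun n : ℕ => (2 : ℝ) ^ n * s) Filter.atTop Filter.atTop :=
    (tendsto_pow_atTop_atTop_of_one_lt one_lt_two).atTop_mul_const hs
  have h3 := tendsto_theta4.comp h2
  simp only [Function.comp_def, h1] at h3
  exact zero_ne_one (tendsto_nhds_unique tendsto_const_nhds h3)

theorem theta4_pos {s : ℝ} (hs : 0 < s) : 0 < theta4 s := by
  have h := theta3_mul_theta4 hs
  have h4 : 0 < theta4 (2 * s) ^ 2 := by
    have := theta4_ne_zero (s := 2 * s) (by positivity)
    positivity
  rw [← h] at h4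
  exact (pos_iff_pos_of_mul_pos h4).1 (theta3_pos hs)

/-- The theta constant `θ₂(4 s) = θ₄(1/(4 s)) / √(4 s)` as a difference of values of `θ₃`. -/
theorem theta4_inv {s : ℝ} (hs : 0 < s) :
    theta4 (1 / (4 * s)) = √(4 * s) * (theta3 s - theta3 (4 * s)) := by
  have h1 := theta3_add_theta4 (s := 1 / (4 * s)) (by positivity)
  have h2 := theta3_inv (s := 4 * s) (by positivity)
  have h3 := theta3_inv hs
  rw [show 4 * (1 / (4 * s)) = 1 / s by field_simp, h2, h3] at h1
  have h4 : √(4 * s) = 2 * √s := by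
    rw [Real.sqrt_mul (by norm_num), show (4 : ℝ) = 2 ^ 2 by norm_num, Real.sqrt_sq (by norm_num)]
  rw [h4] at h1 ⊢
  linarith

/-- Jacobi's identity `θ₃⁴ = θ₂⁴ + θ₄⁴`, with `θ₂(s)²` written as `θ₄(1/s)² / s`. -/
theorem theta_quartic {s : ℝ} (hs : 0 < s) :
    theta3 s ^ 4 = (theta4 (1 / s) ^ 2 / s) ^ 2 + theta4 s ^ 4 := by
  obtain ⟨t, ht, rfl⟩ : ∃ t, 0 < t ∧ s = 2 * t := ⟨s / 2, by positivity, by ring⟩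
  have h1 := theta3_sq_add_theta4_sq ht
  have h2 := theta3_mul_theta4 ht
  have h3 := theta3_add_theta4 ht
  have h4 := theta3_mul_theta4 (s := 1 / (4 * t)) (by positivity)
  rw [theta4_inv ht, theta3_inv (by positivity), show 2 * (1 / (4 * t)) = 1 / (2 * t) by
    field_simp; norm_num] at h4
  have h5 : √(4 * t) * √(4 * t) = 4 * t := Real.mul_self_sqrt (by positivity)
  have h6 : theta4 (1 / (2 * t)) ^ 2 / (2 * t) = (theta3 t ^ 2 - theta4 t ^ 2) / 2 := by
    rw [← h4, div_eq_iff (by positivity)]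
    linear_combination (theta3 (4 * t) * (theta3 t - theta3 (4 * t))) * h5 +
      t * (2 * theta3 (4 * t) - theta3 t + theta4 t) * h3
  rw [h6, show theta3 (2 * t) ^ 4 = (theta3 (2 * t) ^ 2) ^ 2 by ring,
    show theta4 (2 * t) ^ 4 = (theta4 (2 * t) ^ 2) ^ 2 by ring, ← h2]
  have h7 : theta3 (2 * t) ^ 2 = (theta3 t ^ 2 + theta4 t ^ 2) / 2 := by linarith
  rw [h7]
  ring

/-! ### Gauss's transformation of the complete elliptic integral -/

/-- Gauss's symmetric form `∫₀^∞ dt / √((t² + a²)(t² + b²))` of the complete elliptic integral. -/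
noncomputable def gaussIntegral (a b : ℝ) : ℝ :=
  ∫ t in Set.Ioi (0 : ℝ), 1 / √((t ^ 2 + a ^ 2) * (t ^ 2 + b ^ 2))

theorem image_mul_tan_Ioo {b : ℝ} (hb : 0 < b) :
    (fun θ => b * Real.tan θ) '' Set.Ioo 0 (π / 2) = Set.Ioi 0 := by
  ext t
  constructor
  · rintro ⟨θ, hθ, rfl⟩
    exact mul_pos hb (Real.tan_pos_of_pos_of_lt_pi_div_two hθ.1 hθ.2)
  · intro ht
    refine ⟨Real.arctan (t / b), ⟨Real.arctan_pos.2 (div_pos ht hb), Real.arctan_lt_pi_div_two _⟩,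
      ?_⟩
    simp only [Real.tan_arctan]
    field_simp

theorem gaussIntegral_eq {b : ℝ} (a : ℝ) (hb : 0 < b) :
    gaussIntegral a b =
      ∫ θ in (0 : ℝ)..(π / 2), 1 / √(a ^ 2 * Real.cos θ ^ 2 + b ^ 2 * Real.sin θ ^ 2) := by
  have hcos : ∀ θ ∈ Set.Ioo 0 (π / 2), 0 < Real.cos θ := fun θ hθ =>
    Real.cos_pos_of_mem_Ioo ⟨by linarith [hθ.1, Real.pi_pos], hθ.2⟩
  have hderiv : ∀ θ ∈ Set.Ioo 0 (π / 2), HasDerivWithinAt (fun θ => b * Real.tan θ)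
      (b * (1 / Real.cos θ ^ 2)) (Set.Ioo 0 (π / 2)) θ := fun θ hθ =>
    ((Real.hasDerivAt_tan (hcos θ hθ).ne').const_mul b).hasDerivWithinAt
  have hinj : Set.InjOn (fun θ => b * Real.tan θ) (Set.Ioo 0 (π / 2)) := fun x hx y hy hxy =>
    Real.injOn_tan ⟨by linarith [hx.1, Real.pi_pos], hx.2⟩ ⟨by linarith [hy.1, Real.pi_pos], hy.2⟩
      (mul_left_cancel₀ hb.ne' hxy)
  rw [gaussIntegral, ← image_mul_tan_Ioo hb,
    MeasureTheory.integral_image_eq_integral_abs_deriv_smul measurableSet_Ioo hderiv hinj,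
    intervalIntegral.integral_of_le (by positivity), MeasureTheory.integral_Ioc_eq_integral_Ioo]
  refine MeasureTheory.setIntegral_congr_fun measurableSet_Ioo fun θ hθ => ?_
  have hc := hcos θ hθ
  have hs := Real.sin_sq_add_cos_sq θ
  have hrad : ((b * Real.tan θ) ^ 2 + a ^ 2) * ((b * Real.tan θ) ^ 2 + b ^ 2) =
      (b / Real.cos θ ^ 2) ^ 2 * (a ^ 2 * Real.cos θ ^ 2 + b ^ 2 * Real.sin θ ^ 2) := by
    rw [Real.tan_eq_sin_div_cos]
    field_simp
    linear_combination (b ^ 2 * Real.sin θ ^ 2 + a ^ 2 * Real.cos θ ^ 2) * hs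
  have hpos : 0 < b / Real.cos θ ^ 2 := by positivity
  simp only [smul_eq_mul]
  rw [hrad, Real.sqrt_mul (sq_nonneg _), Real.sqrt_sq hpos.le, mul_one_div, mul_one_div b,
    abs_of_pos hpos, div_mul_eq_div_div, div_self hpos.ne']

theorem ellipticK_eq_gaussIntegral {k : ℝ} (hk : k ∈ Set.Ioo (0 : ℝ) 1) :
    ellipticK k = gaussIntegral 1 (complementaryModulus k) := by
  rw [gaussIntegral_eq 1 (complementaryModulus_mem hk).1, ellipticK]
  refine intervalIntegral.integral_congr fun θ _ => ?_
  rw [complementaryModulus, Real.sq_sqrt (by nlinarith [hk.1, hk.2])]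
  congr 2
  linear_combination -Real.sin_sq_add_cos_sq θ

theorem gaussIntegral_mul {a b c : ℝ} (hc : 0 < c) :
    gaussIntegral (c * a) (c * b) = gaussIntegral a b / c := by
  have h := MeasureTheory.integral_comp_mul_left_Ioi
    (fun t => 1 / √((t ^ 2 + (c * a) ^ 2) * (t ^ 2 + (c * b) ^ 2))) 0 hc
  rw [mul_zero, smul_eq_mul, eq_inv_mul_iff_mul_eq₀ hc.ne'] at h
  rw [gaussIntegral, ← h, gaussIntegral, ← MeasureTheory.integral_const_mul,
    ← MeasureTheory.integral_div]
  refine MeasureTheory.setIntegral_congr_fun measurableSet_Ioi fun t _ => ?_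
  rw [show ((c * t) ^ 2 + (c * a) ^ 2) * ((c * t) ^ 2 + (c * b) ^ 2) =
      (c ^ 2) ^ 2 * ((t ^ 2 + a ^ 2) * (t ^ 2 + b ^ 2)) by ring,
    Real.sqrt_mul (sq_nonneg _), Real.sqrt_sq (sq_nonneg c)]
  field_simp

theorem image_landen_Ioi {p : ℝ} (hp : 0 < p) :
    (fun x : ℝ => (x - p / x) / 2) '' Set.Ioi 0 = Set.univ := by
  refine Set.eq_univ_of_forall fun t => ?_
  have hlt : |t| < √(t ^ 2 + p) := by
    rw [← Real.sqrt_sq_eq_abs]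
    exact Real.sqrt_lt_sqrt (sq_nonneg t) (by linarith)
  have hx : 0 < t + √(t ^ 2 + p) := by linarith [neg_abs_le t]
  refine ⟨t + √(t ^ 2 + p), hx, ?_⟩
  have hsq : √(t ^ 2 + p) ^ 2 = t ^ 2 + p := Real.sq_sqrt (by positivity)
  simp only
  field_simp
  linear_combination hsq

/-- Gauss's form of the Landen transformation: the integral is unchanged when `a`, `b` are replaced
by their arithmetic and geometric means. The substitution is `t = (x - a b / x) / 2`, which maps
`(0, ∞)` onto `ℝ`. -/
theorem gaussIntegral_agm {a b : ℝ} (ha : 0 < a) (hb : 0 < b) :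
    gaussIntegral a b = gaussIntegral ((a + b) / 2) √(a * b) := by
  have hab : 0 < a * b := mul_pos ha hb
  have hderiv : ∀ x ∈ Set.Ioi (0 : ℝ), HasDerivWithinAt (fun x : ℝ => (x - a * b / x) / 2)
      ((1 + a * b / x ^ 2) / 2) (Set.Ioi 0) x := fun x hx => by
    have hx0 : x ≠ 0 := (Set.mem_Ioi.1 hx).ne'
    have h := ((hasDerivAt_id x).sub ((hasDerivAt_inv hx0).const_mul (a * b))).div_const 2
    refine (h.congr_deriv ?_).hasDerivWithinAt
    field_simp
    ring
  have hinj : Set.InjOn (fun x : ℝ => (x - a * b / x) / 2) (Set.Ioi 0) := by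
    intro x hx y hy hxy
    have hx0 : 0 < x := hx
    have hy0 : 0 < y := hy
    simp only at hxy
    field_simp at hxy
    have h : (x - y) * (x * y + a * b) = 0 := by linear_combination hxy
    rcases mul_eq_zero.1 h with h | h
    · linarith
    · nlinarith [mul_pos hx0 hy0]
  have heven : ∫ t : ℝ, 1 / √((t ^ 2 + ((a + b) / 2) ^ 2) * (t ^ 2 + √(a * b) ^ 2)) =
      2 * gaussIntegral ((a + b) / 2) √(a * b) := by
    have h := integral_comp_abs
      (f := fun t => 1 / √((t ^ 2 + ((a + b) / 2) ^ 2) * (t ^ 2 + √(a * b) ^ 2)))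
    simpa only [sq_abs, gaussIntegral] using h
  rw [← MeasureTheory.setIntegral_univ, ← image_landen_Ioi hab,
    MeasureTheory.integral_image_eq_integral_abs_deriv_smul measurableSet_Ioi hderiv hinj]
    at heven
  have h2 : 2 * gaussIntegral a b = 2 * gaussIntegral ((a + b) / 2) √(a * b) := by
    rw [← heven, gaussIntegral, ← MeasureTheory.integral_const_mul]
    refine MeasureTheory.setIntegral_congr_fun measurableSet_Ioi fun x hx => ?_
    have hx0 : 0 < x := hx
    have hpos : 0 < (1 + a * b / x ^ 2) / 2 := by positivity
    have hrad : (((x - a * b / x) / 2) ^ 2 + ((a + b) / 2) ^ 2) *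
        (((x - a * b / x) / 2) ^ 2 + √(a * b) ^ 2) =
        ((1 + a * b / x ^ 2) / 2 / 2) ^ 2 * ((x ^ 2 + a ^ 2) * (x ^ 2 + b ^ 2)) := by
      rw [Real.sq_sqrt hab.le]
      field_simp
      ring
    simp only [smul_eq_mul]
    rw [hrad, Real.sqrt_mul (sq_nonneg _), Real.sqrt_sq (by positivity), abs_of_pos hpos]
    have hpos2 : 0 < √((x ^ 2 + a ^ 2) * (x ^ 2 + b ^ 2)) := Real.sqrt_pos.2 (by positivity)
    generalize (1 + a * b / x ^ 2) / 2 = d at hpos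
    field_simp
  linarith

theorem gaussIntegral_bounds {a b m M : ℝ} (hm : 0 < m) (hma : m ≤ a) (hmb : m ≤ b) (haM : a ≤ M)
    (hbM : b ≤ M) : π / 2 / M ≤ gaussIntegral a b ∧ gaussIntegral a b ≤ π / 2 / m := by
  have ha : 0 < a := hm.trans_le hma
  have hb : 0 < b := hm.trans_le hmb
  have hlow : ∀ θ : ℝ, m ^ 2 ≤ a ^ 2 * Real.cos θ ^ 2 + b ^ 2 * Real.sin θ ^ 2 := fun θ => by
    have h1 : m ^ 2 ≤ a ^ 2 := by gcongr
    have h2 : m ^ 2 ≤ b ^ 2 := by gcongr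
    nlinarith [Real.sin_sq_add_cos_sq θ, sq_nonneg (Real.sin θ), sq_nonneg (Real.cos θ)]
  have hupp : ∀ θ : ℝ, a ^ 2 * Real.cos θ ^ 2 + b ^ 2 * Real.sin θ ^ 2 ≤ M ^ 2 := fun θ => by
    have h1 : a ^ 2 ≤ M ^ 2 := by gcongr
    have h2 : b ^ 2 ≤ M ^ 2 := by gcongr
    nlinarith [Real.sin_sq_add_cos_sq θ, sq_nonneg (Real.sin θ), sq_nonneg (Real.cos θ)]
  have hcont : Continuous fun θ : ℝ =>
      1 / √(a ^ 2 * Real.cos θ ^ 2 + b ^ 2 * Real.sin θ ^ 2) := by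
    refine Continuous.div continuous_const (by fun_prop) fun θ => ?_
    exact (Real.sqrt_pos.2 ((pow_pos hm 2).trans_le (hlow θ))).ne'
  have hM : 0 < M := ha.trans_le haM
  rw [gaussIntegral_eq a hb]
  constructor
  · calc π / 2 / M = ∫ _ in (0 : ℝ)..(π / 2), 1 / M := by simp; ring
      _ ≤ _ := intervalIntegral.integral_mono_on (by positivity) (by simp)
        (hcont.intervalIntegrable _ _) fun θ _ => one_div_le_one_div_of_le
          (Real.sqrt_pos.2 ((pow_pos hm 2).trans_le (hlow θ))) (Real.sqrt_le_iff.2 ⟨hM.le, hupp θ⟩)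
  · calc _ ≤ ∫ _ in (0 : ℝ)..(π / 2), 1 / m :=
        intervalIntegral.integral_mono_on (by positivity) (hcont.intervalIntegrable _ _) (by simp)
          fun θ _ => one_div_le_one_div_of_le hm (Real.le_sqrt_of_sq_le (hlow θ))
      _ = π / 2 / m := by simp; ring

/-- The squared theta constants have arithmetic-geometric mean `1`: passing from `s` to `2 s`
replaces them by their two means, and they tend to `1`. -/
theorem gaussIntegral_theta {s : ℝ} (hs : 0 < s) :
    gaussIntegral (theta3 s ^ 2) (theta4 s ^ 2) = π / 2 := by
  refine eq_of_doubling (f := fun s => gaussIntegral (theta3 s ^ 2) (theta4 s ^ 2))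
    (fun s hs => ?_) ?_ hs
  · have h3 := theta3_pos hs
    have h4 := theta4_pos hs
    rw [gaussIntegral_agm (pow_pos h3 2) (pow_pos h4 2), theta3_sq_add_theta4_sq hs,
      mul_div_cancel_left₀ _ two_ne_zero, ← mul_pow, Real.sqrt_sq (mul_pos h3 h4).le,
      theta3_mul_theta4 hs]
  · have h3 := tendsto_theta3.pow 2
    have h4 := tendsto_theta4.pow 2
    have hmin : Filter.Tendsto (fun s => π / 2 / min (theta3 s ^ 2) (theta4 s ^ 2)) Filter.atTop
        (nhds (π / 2)) := by
      simpa [Pi.div_def] using (tendsto_const_nhds (x := π / 2)).div (h3.min h4) (by simp)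
    have hmax : Filter.Tendsto (fun s => π / 2 / max (theta3 s ^ 2) (theta4 s ^ 2)) Filter.atTop
        (nhds (π / 2)) := by
      simpa [Pi.div_def] using (tendsto_const_nhds (x := π / 2)).div (h3.max h4) (by simp)
    have hb : ∀ᶠ s in Filter.atTop,
        π / 2 / max (theta3 s ^ 2) (theta4 s ^ 2) ≤ gaussIntegral (theta3 s ^ 2) (theta4 s ^ 2) ∧
        gaussIntegral (theta3 s ^ 2) (theta4 s ^ 2) ≤
          π / 2 / min (theta3 s ^ 2) (theta4 s ^ 2) := by
      filter_upwards [Filter.eventually_gt_atTop 0] with s hs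
      exact gaussIntegral_bounds (lt_min (pow_pos (theta3_pos hs) 2) (pow_pos (theta4_pos hs) 2))
        (min_le_left _ _) (min_le_right _ _) (le_max_left _ _) (le_max_right _ _)
    exact tendsto_of_tendsto_of_tendsto_of_le_of_le' hmax hmin (hb.mono fun _ h => h.1)
      (hb.mono fun _ h => h.2)

/-! ### The singular modulus in terms of theta constants -/

theorem theta4_lt_theta3 {s : ℝ} (hs : 0 < s) : theta4 s < theta3 s := by
  have h := theta_quartic hs
  have h4 : 0 < (theta4 (1 / s) ^ 2 / s) ^ 2 := by
    have := theta4_pos (s := 1 / s) (by positivity)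
    positivity
  exact lt_of_pow_lt_pow_left₀ 4 (theta3_pos hs).le (by linarith)

theorem theta_ratio_mem {s : ℝ} (hs : 0 < s) :
    theta4 s ^ 2 / theta3 s ^ 2 ∈ Set.Ioo (0 : ℝ) 1 := by
  have h3 := theta3_pos hs
  have h4 := theta4_pos hs
  refine ⟨by positivity, (div_lt_one (by positivity)).2 ?_⟩
  have := theta4_lt_theta3 hs
  gcongr

theorem gaussIntegral_theta_ratio {s : ℝ} (hs : 0 < s) :
    gaussIntegral 1 (theta4 s ^ 2 / theta3 s ^ 2) = π / 2 * theta3 s ^ 2 := by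
  have h3 := theta3_pos hs
  have h := gaussIntegral_mul (a := 1) (b := theta4 s ^ 2 / theta3 s ^ 2) (pow_pos h3 2)
  rw [mul_one, mul_div_cancel₀ _ (pow_pos h3 2).ne', gaussIntegral_theta hs] at h
  field_simp at h ⊢
  linarith

/-- The modular transformation `s ↦ 1/s` exchanges the modulus with the complementary modulus. -/
theorem complementaryModulus_theta_ratio {s : ℝ} (hs : 0 < s) :
    complementaryModulus (theta4 s ^ 2 / theta3 s ^ 2) =
      theta4 (1 / s) ^ 2 / theta3 (1 / s) ^ 2 := by
  have h3 := theta3_pos hs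
  have h := theta_quartic hs
  rw [theta3_inv hs, mul_pow, Real.sq_sqrt hs.le, complementaryModulus]
  refine (Real.sqrt_eq_iff_mul_self_eq_of_pos ?_).2 ?_
  · have := theta4_pos (s := 1 / s) (by positivity)
    positivity
  · field_simp at h ⊢
    linear_combination -h

theorem singularModulus_eq {r : ℝ} (hr : 0 < r) :
    singularModulus r = complementaryModulus (theta4 √r ^ 2 / theta3 √r ^ 2) := by
  have hs : 0 < √r := Real.sqrt_pos.2 hr
  have hmem := theta_ratio_mem hs
  have hmem' := complementaryModulus_mem hmem
  refine (existsUnique_singularModulus hr).unique (singularModulus_spec hr) ⟨hmem', ?_⟩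
  rw [ellipticK_eq_gaussIntegral (complementaryModulus_mem hmem'),
    ellipticK_eq_gaussIntegral hmem', complementaryModulus_invol hmem',
    complementaryModulus_invol hmem, gaussIntegral_theta_ratio hs,
    complementaryModulus_theta_ratio hs, gaussIntegral_theta_ratio (by positivity), theta3_inv hs,
    mul_pow, Real.sq_sqrt hs.le]
  have h3 := theta3_pos hs
  field_simp

theorem quarterPeriod_eq {r : ℝ} (hr : 0 < r) :
    quarterPeriod r = π / 2 * theta3 √r ^ 2 := by
  have hs : 0 < √r := Real.sqrt_pos.2 hr
  have hmem := theta_ratio_mem hs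
  rw [quarterPeriod, singularModulus_eq hr,
    ellipticK_eq_gaussIntegral (complementaryModulus_mem hmem), complementaryModulus_invol hmem,
    gaussIntegral_theta_ratio hs]

/-! ### The Lambert series of the square of `θ₃` -/

/-- The sum of `1 / cosh (π s n)` over `n ∈ ℤ`. In terms of `q = exp (-π s)` the summand is
`2 q ^ n / (1 + q ^ (2 n))`. -/
noncomputable def sechSum (s : ℝ) : ℝ := ∑' n : ℤ, (Real.cosh (π * s * n))⁻¹

/-- The alternating sum of `1 / cosh (π s n)` over `n ∈ ℤ`. -/
noncomputable def sechSumAlt (s : ℝ) : ℝ := ∑' n : ℤ, (-1 : ℝ) ^ n * (Real.cosh (π * s * n))⁻¹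

theorem inv_cosh_le (x : ℝ) : (Real.cosh x)⁻¹ ≤ 2 * Real.exp (-|x|) := by
  rw [← Real.cosh_abs, Real.exp_neg, inv_le_iff_one_le_mul₀ (Real.cosh_pos _), Real.cosh_eq]
  have h1 := Real.exp_pos |x|
  have h2 := Real.exp_pos (-|x|)
  field_simp
  linarith

theorem inv_cosh_le_one (x : ℝ) : (Real.cosh x)⁻¹ ≤ 1 := inv_le_one_of_one_le₀ (Real.one_le_cosh x)

theorem one_add_exp_mul_inv_cosh (x : ℝ) :
    (1 + Real.exp (-(2 * x))) * (Real.cosh x)⁻¹ = 2 * Real.exp (-x) := by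
  rw [mul_inv_eq_iff_eq_mul₀ (Real.cosh_pos x).ne', Real.cosh_eq,
    show -(2 * x) = -x + -x by ring, Real.exp_add, Real.exp_neg]
  field_simp

theorem summable_inv_cosh {s : ℝ} (hs : 0 < s) :
    Summable fun n : ℤ => (Real.cosh (π * s * n))⁻¹ := by
  have h1 : Summable fun n : ℕ => (Real.cosh (π * s * n))⁻¹ := by
    have hg : Summable fun n : ℕ => 2 * Real.exp (-(π * s)) ^ n :=
      (summable_geometric_of_lt_one (Real.exp_pos _).le
        (Real.exp_lt_one_iff.2 (neg_lt_zero.2 (by positivity)))).mul_left 2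
    refine hg.of_nonneg_of_le (fun n => (inv_pos.2 (Real.cosh_pos _)).le) fun n => ?_
    refine (inv_cosh_le _).trans_eq ?_
    rw [abs_of_nonneg (by positivity), ← Real.exp_nat_mul]
    congr 2
    ring
  refine Summable.of_nat_of_neg (by simpa using h1) (h1.congr fun n => ?_)
  rw [← Real.cosh_neg]
  push_cast
  ring_nf

theorem sechSum_add_sechSumAlt {s : ℝ} (hs : 0 < s) :
    sechSum s + sechSumAlt s = 2 * sechSum (2 * s) := by
  rw [sechSum, sechSumAlt, tsum_add_tsum_alternating (summable_inv_cosh hs), sechSum]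
  congr 1
  refine tsum_congr fun n => ?_
  push_cast
  ring_nf

theorem tendsto_sechSum : Filter.Tendsto sechSum Filter.atTop (nhds 1) := by
  refine tendsto_tsum_one (summable_inv_cosh one_pos) (fun s hs n => ?_) fun n => ?_
  · rw [abs_of_pos (inv_pos.2 (Real.cosh_pos _))]
    refine inv_anti₀ (Real.cosh_pos _) (Real.cosh_le_cosh.2 ?_)
    rw [abs_mul, abs_mul (π * s)]
    refine mul_le_mul_of_nonneg_right ?_ (abs_nonneg _)
    rw [abs_of_pos (by positivity), abs_of_pos (by positivity)]
    nlinarith [Real.pi_pos]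
  · split_ifs with h
    · simp [h]
    · have hn : 0 < π * |(n : ℝ)| := by positivity
      have h0 : Filter.Tendsto (fun s : ℝ => 2 * Real.exp (-|π * s * n|)) Filter.atTop
          (nhds 0) := by
        have h1 := (Real.tendsto_exp_neg_atTop_nhds_zero.comp
          (Filter.tendsto_id.const_mul_atTop hn)).const_mul 2
        rw [mul_zero] at h1
        refine h1.congr' ?_
        filter_upwards [Filter.eventually_ge_atTop 0] with s hs
        simp only [Function.comp, id]
        rw [abs_mul, abs_mul, abs_of_pos Real.pi_pos, abs_of_nonneg hs]
        ring_nf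
      exact squeeze_zero (fun s => (inv_pos.2 (Real.cosh_pos _)).le) (fun s => inv_cosh_le _) h0

/-- The product of two absolutely convergent series over `ℤ`, summed by diagonals. -/
theorem tsum_mul_tsum_eq_tsum_convolution {f g : ℤ → ℝ} (hf : Summable f) (hg : Summable g) :
    (∑' n, f n) * ∑' n, g n = ∑' n, ∑' j, f (n - j) * g j := by
  let e : ℤ × ℤ ≃ ℤ × ℤ :=
    ⟨fun p => (p.1 - p.2, p.2), fun p => (p.1 + p.2, p.2), fun p => by simp, fun p => by simp⟩
  have hsum := summable_mul_of_summable_norm hf.norm hg.norm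
  rw [tsum_mul_tsum_of_summable_norm hf.norm hg.norm,
    ← e.tsum_eq fun p : ℤ × ℤ => f p.1 * g p.2]
  exact ((e.summable_iff (f := fun p : ℤ × ℤ => f p.1 * g p.2)).2 hsum).tsum_prod

/-- The coefficient `∑ (-1) ^ (n - j) q ^ (j ^ 2 - 2 n j) / cosh (π s j)` over `j ∈ ℤ`, where
`q = exp (-π s)`: up to the factor `q ^ (n ^ 2)`, the `n`-th Fourier coefficient of the product of
the theta function `∑ (-1) ^ m q ^ (m ^ 2) z ^ m` and the series `∑ z ^ j / cosh (π s j)`. -/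
noncomputable def thetaSechCoeff (s : ℝ) (n : ℤ) : ℝ :=
  ∑' j : ℤ, (-1 : ℝ) ^ (n - j) *
    (Real.exp (-π * s * ((j : ℝ) ^ 2 + (-2 * n) * j)) * (Real.cosh (π * s * j))⁻¹)

theorem summable_thetaSechCoeff {s : ℝ} (hs : 0 < s) (n k : ℤ) :
    Summable fun j : ℤ => (-1 : ℝ) ^ (k - j) *
      (Real.exp (-π * s * ((j : ℝ) ^ 2 + (-2 * n) * j)) * (Real.cosh (π * s * j))⁻¹) := by
  refine (summable_exp_quadratic hs (-2 * n)).of_norm_bounded fun j => ?_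
  rw [Real.norm_eq_abs, abs_mul, abs_neg_one_zpow, one_mul, abs_of_pos (mul_pos (Real.exp_pos _)
    (inv_pos.2 (Real.cosh_pos _)))]
  exact mul_le_of_le_one_right (Real.exp_pos _).le (inv_cosh_le_one _)

/-- The reflection `j ↦ 2 n - 1 - j` reverses the sign of every term. -/
theorem tsum_alternating_reflection (s : ℝ) (n : ℤ) :
    ∑' j : ℤ, (-1 : ℝ) ^ (n - j) * Real.exp (-π * s * ((j : ℝ) ^ 2 + (1 - 2 * n) * j)) = 0 := by
  have h := (Equiv.subLeft (2 * n - 1)).tsum_eq fun j : ℤ =>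
    (-1 : ℝ) ^ (n - j) * Real.exp (-π * s * ((j : ℝ) ^ 2 + (1 - 2 * n) * j))
  have h2 : ∀ j : ℤ, (-1 : ℝ) ^ (n - (2 * n - 1 - j)) *
      Real.exp (-π * s * (((2 * n - 1 - j : ℤ) : ℝ) ^ 2 + (1 - 2 * n) * (2 * n - 1 - j : ℤ))) =
      -((-1 : ℝ) ^ (n - j) * Real.exp (-π * s * ((j : ℝ) ^ 2 + (1 - 2 * n) * j))) := fun j => by
    rw [show n - (2 * n - 1 - j) = (n - j) + (2 * (j - n) + 1) by ring, zpow_add₀ (by norm_num),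
      (odd_two_mul_add_one (j - n)).neg_one_zpow]
    push_cast
    ring_nf
  simp only [Equiv.subLeft_apply, h2, tsum_neg] at h
  linarith

theorem thetaSechCoeff_sub_one {s : ℝ} (hs : 0 < s) (n : ℤ) :
    thetaSechCoeff s (n - 1) = thetaSechCoeff s n := by
  rw [eq_comm, ← sub_eq_zero, thetaSechCoeff, thetaSechCoeff,
    ← (summable_thetaSechCoeff hs n n).tsum_sub (summable_thetaSechCoeff hs (n - 1) (n - 1)),
    ← mul_eq_zero_of_right 2 (tsum_alternating_reflection s n), ← tsum_mul_left]
  refine tsum_congr fun j => ?_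
  have h := one_add_exp_mul_inv_cosh (π * s * j)
  have e1 : Real.exp (-π * s * ((j : ℝ) ^ 2 + (-2 * (n - 1 : ℤ)) * j)) =
      Real.exp (-π * s * ((j : ℝ) ^ 2 + (-2 * n) * j)) * Real.exp (-(2 * (π * s * j))) := by
    rw [← Real.exp_add]
    push_cast
    ring_nf
  have e2 : Real.exp (-π * s * ((j : ℝ) ^ 2 + (1 - 2 * n) * j)) =
      Real.exp (-π * s * ((j : ℝ) ^ 2 + (-2 * n) * j)) * Real.exp (-(π * s * j)) := by
    rw [← Real.exp_add]
    ring_nf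
  rw [e1, e2, show n - 1 - j = (n - j) + (-1) by ring, zpow_add₀ (by norm_num), zpow_neg_one,
    inv_neg_one]
  linear_combination ((-1 : ℝ) ^ (n - j) *
    Real.exp (-π * s * ((j : ℝ) ^ 2 + (-2 * n) * j))) * h

theorem thetaSechCoeff_eq {s : ℝ} (hs : 0 < s) (n : ℤ) :
    thetaSechCoeff s n = thetaSechCoeff s 0 := by
  induction n using Int.induction_on with
  | zero => rfl
  | succ n ih =>
    rw [← ih, ← thetaSechCoeff_sub_one hs (n + 1), add_sub_cancel_right]
  | pred n ih => rw [← ih, thetaSechCoeff_sub_one hs]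

theorem tsum_alternating_exp_sq_sub_mul_inv_cosh {s : ℝ} (hs : 0 < s) (n : ℤ) :
    ∑' j : ℤ, (-1 : ℝ) ^ (n - j) * Real.exp (-π * s * ((n - j : ℤ) : ℝ) ^ 2) *
      (Real.cosh (π * s * j))⁻¹ =
    thetaSechCoeff s 0 * Real.exp (-π * s * (n : ℝ) ^ 2) := by
  rw [← thetaSechCoeff_eq hs n, mul_comm (thetaSechCoeff s n), thetaSechCoeff, ← tsum_mul_left]
  refine tsum_congr fun j => ?_
  have e : Real.exp (-π * s * ((n - j : ℤ) : ℝ) ^ 2) = Real.exp (-π * s * (n : ℝ) ^ 2) *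
      Real.exp (-π * s * ((j : ℝ) ^ 2 + (-2 * n) * j)) := by
    rw [← Real.exp_add]
    push_cast
    ring_nf
  rw [e]
  ring

theorem theta4_mul_sechSum {s : ℝ} (hs : 0 < s) :
    theta4 s * sechSum s = thetaSechCoeff s 0 * theta3 s := by
  rw [theta4, sechSum, tsum_mul_tsum_eq_tsum_convolution (summable_alternating_exp_sq hs)
    (summable_inv_cosh hs), theta3, ← tsum_mul_left]
  exact tsum_congr fun n => tsum_alternating_exp_sq_sub_mul_inv_cosh hs n

theorem theta3_mul_sechSumAlt {s : ℝ} (hs : 0 < s) :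
    theta3 s * sechSumAlt s = thetaSechCoeff s 0 * theta4 s := by
  rw [theta3, sechSumAlt, tsum_mul_tsum_eq_tsum_convolution (summable_exp_sq hs)
    (summable_alternating (summable_inv_cosh hs).abs), theta4, ← tsum_mul_left]
  refine tsum_congr fun n => ?_
  rw [mul_left_comm, ← tsum_alternating_exp_sq_sub_mul_inv_cosh hs n, ← tsum_mul_left]
  refine tsum_congr fun j => ?_
  have h : (-1 : ℝ) ^ n * (-1 : ℝ) ^ (n - j) = (-1 : ℝ) ^ j := by
    rw [← zpow_add₀ (by norm_num), show n + (n - j) = j + 2 * (n - j) by ring,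
      zpow_add₀ (by norm_num), (even_two_mul (n - j)).neg_one_zpow, mul_one]
  rw [← h]
  ring

/-- The Lambert series of `θ₃²`, a form of Jacobi's two-square theorem. The ratio of the two sides
is invariant under `s ↦ 2 s`, and tends to `1` at infinity. -/
theorem sechSum_eq {s : ℝ} (hs : 0 < s) : sechSum s = theta3 s ^ 2 := by
  have h : sechSum s / theta3 s ^ 2 = 1 := by
    refine eq_of_doubling (f := fun s => sechSum s / theta3 s ^ 2) (fun s hs => ?_) ?_ hs
    · have h3 := theta3_pos hs
      have h4 := theta4_pos hs
      have e1 : sechSum s = thetaSechCoeff s 0 * theta3 s / theta4 s := by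
        rw [← theta4_mul_sechSum hs]
        field_simp
      have e2 : sechSumAlt s = thetaSechCoeff s 0 * theta4 s / theta3 s := by
        rw [← theta3_mul_sechSumAlt hs]
        field_simp
      have e3 := sechSum_add_sechSumAlt hs
      have e4 := theta3_sq_add_theta4_sq hs
      have e5 : sechSum (2 * s) = (sechSum s + sechSumAlt s) / 2 := by linarith
      have e6 : theta3 (2 * s) ^ 2 = (theta3 s ^ 2 + theta4 s ^ 2) / 2 := by linarith
      rw [e5, e6, e1, e2]
      field_simp
    · simpa [Pi.div_def] using tendsto_sechSum.div (tendsto_theta3.pow 2) (by simp)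
  rwa [div_eq_one_iff_eq (pow_pos (theta3_pos hs) 2).ne'] at h

/-! ### Meromorphic functions in normal form -/

/-- Identity theorem: meromorphic functions on `ℂ` in normal form that agree near one point are
equal. -/
theorem MeromorphicNFOn.eq_of_eventuallyEq {f g : ℂ → ℂ} (hf : MeromorphicNFOn f Set.univ)
    (hg : MeromorphicNFOn g Set.univ) {z₀ : ℂ} (h : f =ᶠ[nhds z₀] g) : f = g := by
  have hsub : MeromorphicOn (f - g) Set.univ := hf.meromorphicOn.sub hg.meromorphicOn
  have h0 : meromorphicOrderAt (f - g) z₀ = ⊤ := by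
    rw [meromorphicOrderAt_eq_top_iff]
    filter_upwards [h.filter_mono nhdsWithin_le_nhds] with z hz
    simp [hz]
  funext z
  have h1 : meromorphicOrderAt (f - g) z = ⊤ := by
    by_contra hne
    exact hsub.meromorphicOrderAt_ne_top_of_isPreconnected isPreconnected_univ (Set.mem_univ z)
      (Set.mem_univ z₀) hne h0
  have h2 : f =ᶠ[nhdsWithin z {z}ᶜ] g := by
    filter_upwards [meromorphicOrderAt_eq_top_iff.1 h1] with w hw
    exact sub_eq_zero.1 hw
  exact (((hf (Set.mem_univ z)).eventuallyEq_nhdsNE_iff_eventuallyEq_nhds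
    (hg (Set.mem_univ z))).1 h2).eq_of_nhds

theorem toMeromorphicNFOn_eventuallyEq {f : ℂ → ℂ} (hf : MeromorphicOn f Set.univ) {z : ℂ}
    (hz : AnalyticAt ℂ f z) : toMeromorphicNFOn f Set.univ =ᶠ[nhds z] f :=
  ((meromorphicNFOn_toMeromorphicNFOn f Set.univ
    (Set.mem_univ z)).eventuallyEq_nhdsNE_iff_eventuallyEq_nhds hz.meromorphicNFAt).1
    (hf.toMeromorphicNFOn_eq_self_on_nhdsNE (Set.mem_univ z))

/-! ### The partial fraction series -/

/-- The partial fraction series `∑ q ^ m / (1 + q ^ (2 m + 1) x)` over `m ∈ ℕ`. -/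
noncomputable def poleSeries (q : ℝ) (x : ℂ) : ℂ :=
  ∑' m : ℕ, (q : ℂ) ^ m / (1 + (q : ℂ) ^ (2 * m + 1) * x)

section poleSeries

variable {q : ℝ}

theorem half_le_norm_one_add_pow_mul (h0 : 0 < q) (h1 : q < 1) {R : ℝ} {M : ℕ}
    (hM : q ^ M * R ≤ 1 / 2) {x : ℂ} (hx : ‖x‖ ≤ R) (i : ℕ) :
    1 / 2 ≤ ‖1 + (q : ℂ) ^ (2 * (i + M) + 1) * x‖ := by
  have h2 : ‖(q : ℂ) ^ (2 * (i + M) + 1) * x‖ ≤ 1 / 2 := by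
    rw [norm_mul, norm_pow, Complex.norm_real, Real.norm_of_nonneg h0.le]
    calc q ^ (2 * (i + M) + 1) * ‖x‖ ≤ q ^ M * R :=
          mul_le_mul (pow_le_pow_of_le_one h0.le h1.le (by omega)) hx (norm_nonneg _) (by positivity)
      _ ≤ 1 / 2 := hM
  have h3 := norm_sub_le_norm_add (1 : ℂ) ((q : ℂ) ^ (2 * (i + M) + 1) * x)
  rw [norm_one] at h3
  linarith

theorem norm_poleSeries_term_le (h0 : 0 < q) (h1 : q < 1) {R : ℝ} {M : ℕ}
    (hM : q ^ M * R ≤ 1 / 2) {x : ℂ} (hx : ‖x‖ ≤ R) (i : ℕ) :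
    ‖(q : ℂ) ^ (i + M) / (1 + (q : ℂ) ^ (2 * (i + M) + 1) * x)‖ ≤ 2 * q ^ i := by
  have h2 := half_le_norm_one_add_pow_mul h0 h1 hM hx i
  rw [norm_div, norm_pow, Complex.norm_real, Real.norm_of_nonneg h0.le,
    div_le_iff₀ (by linarith)]
  have h3 : q ^ (i + M) ≤ q ^ i := pow_le_pow_of_le_one h0.le h1.le (by omega)
  have h4 : 0 < q ^ i := by positivity
  nlinarith

/-- Near any point, the series is the sum of finitely many terms and an analytic function. -/
theorem exists_poleSeries_eq_sum_add (h0 : 0 < q) (h1 : q < 1) (x : ℂ) :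
    ∃ (M : ℕ) (t : ℂ → ℂ), AnalyticAt ℂ t x ∧ ∀ᶠ y in nhds x, poleSeries q y =
      ∑ m ∈ Finset.range M, (q : ℂ) ^ m / (1 + (q : ℂ) ^ (2 * m + 1) * y) + t y := by
  obtain ⟨M, hM⟩ : ∃ M : ℕ, q ^ M * (‖x‖ + 1) ≤ 1 / 2 := by
    have h := (tendsto_pow_atTop_nhds_zero_of_lt_one h0.le h1).mul_const (‖x‖ + 1)
    rw [zero_mul] at h
    exact (h.eventually (ge_mem_nhds (by norm_num : (0 : ℝ) < 1 / 2))).exists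
  have hball : ∀ y ∈ Metric.ball x 1, ‖y‖ ≤ ‖x‖ + 1 := fun y hy => by
    have h := norm_sub_norm_le y x
    rw [← dist_eq_norm] at h
    linarith [Metric.mem_ball.1 hy]
  have hsum : Summable fun i : ℕ => 2 * q ^ i := (summable_geometric_of_lt_one h0.le h1).mul_left 2
  refine ⟨M, fun y => ∑' i : ℕ, (q : ℂ) ^ (i + M) / (1 + (q : ℂ) ^ (2 * (i + M) + 1) * y), ?_, ?_⟩
  · refine DifferentiableOn.analyticAt (s := Metric.ball x 1) ?_ (Metric.ball_mem_nhds x one_pos)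
    refine Complex.differentiableOn_tsum_of_summable_norm hsum (fun i => ?_) Metric.isOpen_ball
      fun i y hy => norm_poleSeries_term_le h0 h1 hM (hball y hy) i
    refine DifferentiableOn.div (by fun_prop) (by fun_prop) fun y hy => ?_
    have := half_le_norm_one_add_pow_mul h0 h1 hM (hball y hy) i
    exact norm_pos_iff.1 (by linarith)
  · filter_upwards [Metric.ball_mem_nhds x one_pos] with y hy
    refine (Summable.sum_add_tsum_nat_add M ?_).symm
    refine (summable_nat_add_iff M).1 ?_
    exact hsum.of_norm_bounded fun i => norm_poleSeries_term_le h0 h1 hM (hball y hy) i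

theorem meromorphicAt_poleSeries (h0 : 0 < q) (h1 : q < 1) (x : ℂ) :
    MeromorphicAt (poleSeries q) x := by
  obtain ⟨M, t, ht, h⟩ := exists_poleSeries_eq_sum_add h0 h1 x
  have hm : MeromorphicAt (fun y => ∑ m ∈ Finset.range M,
      (q : ℂ) ^ m / (1 + (q : ℂ) ^ (2 * m + 1) * y) + t y) x := by
    refine MeromorphicAt.fun_add (MeromorphicAt.fun_sum fun m _ => ?_) ht.meromorphicAt
    exact MeromorphicAt.fun_div (by fun_prop) (by fun_prop)
  exact hm.congr ((Filter.EventuallyEq.symm h).filter_mono nhdsWithin_le_nhds)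

theorem analyticAt_poleSeries (h0 : 0 < q) (h1 : q < 1) {x : ℂ}
    (hx : ∀ m : ℕ, 1 + (q : ℂ) ^ (2 * m + 1) * x ≠ 0) : AnalyticAt ℂ (poleSeries q) x := by
  obtain ⟨M, t, ht, h⟩ := exists_poleSeries_eq_sum_add h0 h1 x
  refine AnalyticAt.congr ?_ (Filter.EventuallyEq.symm h)
  refine AnalyticAt.fun_add (Finset.analyticAt_fun_sum _ fun m _ => ?_) ht
  exact AnalyticAt.fun_div (by fun_prop) (by fun_prop) (hx m)

theorem one_add_pow_mul_ne_zero (h0 : 0 < q) (h1 : q < 1) {x : ℂ} (hx : q * ‖x‖ < 1) (m : ℕ) :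
    1 + (q : ℂ) ^ (2 * m + 1) * x ≠ 0 := by
  intro h
  have h2 : ‖(q : ℂ) ^ (2 * m + 1) * x‖ = 1 := by
    rw [eq_neg_of_add_eq_zero_right h, norm_neg, norm_one]
  rw [norm_mul, norm_pow, Complex.norm_real, Real.norm_of_nonneg h0.le] at h2
  have h3 : q ^ (2 * m + 1) ≤ q ^ 1 := pow_le_pow_of_le_one h0.le h1.le (by omega)
  rw [pow_one] at h3
  nlinarith [norm_nonneg x]

/-- The power series expansion of `poleSeries` in the disc `‖x‖ < 1 / q`: both sides are the double
series with terms `(-1) ^ n q ^ n x ^ n q ^ ((2 n + 1) m)`. -/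
theorem hasSum_poleSeries (h0 : 0 < q) (h1 : q < 1) {x : ℂ} (hx : q * ‖x‖ < 1) :
    HasSum (fun n : ℕ => (-1) ^ n * (q : ℂ) ^ n * x ^ n / (1 - (q : ℂ) ^ (2 * n + 1)))
      (poleSeries q x) := by
  obtain ⟨a, ha⟩ : ∃ a : ℕ × ℕ → ℂ, ∀ p, a p = (-1) ^ p.1 * (q : ℂ) ^ p.1 * x ^ p.1 *
    ((q : ℂ) ^ (2 * p.1 + 1)) ^ p.2 := ⟨_, fun _ => rfl⟩
  have hq : ‖(q : ℂ)‖ = q := by rw [Complex.norm_real, Real.norm_of_nonneg h0.le]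
  have hpow : ∀ n : ℕ, q ^ (2 * n + 1) ≤ q := fun n => by
    simpa using pow_le_pow_of_le_one h0.le h1.le (show 1 ≤ 2 * n + 1 by omega)
  have hsum : Summable a := by
    have hg : Summable fun p : ℕ × ℕ => (q * ‖x‖) ^ p.1 * q ^ p.2 :=
      Summable.mul_of_nonneg (summable_geometric_of_lt_one (by positivity) hx)
        (summable_geometric_of_lt_one h0.le h1) (fun n => by positivity) (fun n => by positivity)
    refine hg.of_norm_bounded fun p => ?_
    simp only [ha, norm_mul, norm_pow, norm_neg, norm_one, one_pow, one_mul, hq, mul_pow]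
    have := pow_le_pow_left₀ (by positivity) (hpow p.1) p.2
    gcongr
  have hrow : ∀ n : ℕ, HasSum (fun m => a (n, m))
      ((-1) ^ n * (q : ℂ) ^ n * x ^ n / (1 - (q : ℂ) ^ (2 * n + 1))) := fun n => by
    have hlt : ‖(q : ℂ) ^ (2 * n + 1)‖ < 1 := by
      rw [norm_pow, hq]
      exact (hpow n).trans_lt h1
    rw [div_eq_mul_inv]
    exact ((hasSum_geometric_of_norm_lt_one hlt).mul_left _).congr_fun fun m => ha (n, m)
  have hcol : ∀ m : ℕ, HasSum (fun n => a (n, m))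
      ((q : ℂ) ^ m / (1 + (q : ℂ) ^ (2 * m + 1) * x)) := fun m => by
    have hlt : ‖-((q : ℂ) ^ (2 * m + 1) * x)‖ < 1 := by
      rw [norm_neg, norm_mul, norm_pow, hq]
      exact (mul_le_mul_of_nonneg_right (hpow m) (norm_nonneg x)).trans_lt hx
    have h := (hasSum_geometric_of_norm_lt_one hlt).mul_left ((q : ℂ) ^ m)
    rw [sub_neg_eq_add, ← div_eq_mul_inv] at h
    refine h.congr_fun fun n => ?_
    simp only [ha]
    rw [neg_pow (_ * x), mul_pow, ← pow_mul, ← pow_mul]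
    ring
  have h2 : HasSum (fun p : ℕ × ℕ => a p.swap) (∑' p, a p) :=
    (Equiv.prodComm ℕ ℕ).hasSum_iff.2 hsum.hasSum
  have h3 := h2.prod_fiberwise hcol
  rw [poleSeries, h3.tsum_eq]
  exact hsum.hasSum.prod_fiberwise hrow

end poleSeries

/-! ### The continuation of `cd₁` -/

theorem nome_pos (r : ℝ) : 0 < nome r := Real.exp_pos _

theorem nome_lt_one {r : ℝ} (hr : 0 < r) : nome r < 1 :=
  Real.exp_lt_one_iff.2 (neg_lt_zero.2 (mul_pos Real.pi_pos (Real.sqrt_pos.2 hr)))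

theorem quarterPeriod_pos {r : ℝ} (hr : 0 < r) : 0 < quarterPeriod r :=
  ellipticK_pos (singularModulus_spec hr).1

theorem quarterPeriod'_eq {r : ℝ} (hr : 0 < r) : quarterPeriod' r = √r * quarterPeriod r :=
  (div_eq_iff (quarterPeriod_pos hr).ne').1 (singularModulus_spec hr).2

/-- The phase `i π u / (2 K)`. -/
noncomputable def phase (r : ℝ) (u : ℂ) : ℂ := Complex.I * (π / (2 * quarterPeriod r)) * u

/-- The continuation of `cd₁` by partial fractions: with `w = exp (i π u / (2 K))` and `H` the
function `poleSeries`, it is `π / (K k) * √q * (w ^ 3 H(w ^ 2) + w ^ (-3) H(w ^ (-2)))`. Its value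
at the poles of a summand, where a denominator vanishes, carries no meaning. -/
noncomputable def cd₁Continuation (r : ℝ) (u : ℂ) : ℂ :=
  (2 * π / (quarterPeriod r * singularModulus r) : ℝ) * ((√(nome r) : ℝ) / 2 *
    (Complex.exp (3 * phase r u) * poleSeries (nome r) (Complex.exp (2 * phase r u)) +
      Complex.exp (-(3 * phase r u)) * poleSeries (nome r) (Complex.exp (-(2 * phase r u)))))

theorem analyticAt_phase (r : ℝ) (u : ℂ) : AnalyticAt ℂ (phase r) u := by
  unfold phase
  fun_prop

theorem meromorphicOn_cd₁Continuation {r : ℝ} (hr : 0 < r) :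
    MeromorphicOn (cd₁Continuation r) Set.univ := by
  intro u _
  have hp := analyticAt_phase r u
  have h1 : MeromorphicAt (fun u => poleSeries (nome r) (Complex.exp (2 * phase r u))) u :=
    (meromorphicAt_poleSeries (nome_pos r) (nome_lt_one hr) _).comp_analyticAt
      (g := fun u => Complex.exp (2 * phase r u)) (by fun_prop)
  have h2 : MeromorphicAt (fun u => poleSeries (nome r) (Complex.exp (-(2 * phase r u)))) u :=
    (meromorphicAt_poleSeries (nome_pos r) (nome_lt_one hr) _).comp_analyticAt
      (g := fun u => Complex.exp (-(2 * phase r u))) (by fun_prop)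
  have h3 : MeromorphicAt (fun u => Complex.exp (3 * phase r u)) u :=
    AnalyticAt.meromorphicAt (by fun_prop)
  have h4 : MeromorphicAt (fun u => Complex.exp (-(3 * phase r u))) u :=
    AnalyticAt.meromorphicAt (by fun_prop)
  exact (MeromorphicAt.const _ u).fun_mul ((MeromorphicAt.const _ u).fun_mul
    ((h3.fun_mul h1).fun_add (h4.fun_mul h2)))

theorem analyticAt_cd₁Continuation {r : ℝ} (hr : 0 < r) {u : ℂ}
    (h1 : ∀ m : ℕ, 1 + (nome r : ℂ) ^ (2 * m + 1) * Complex.exp (2 * phase r u) ≠ 0)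
    (h2 : ∀ m : ℕ, 1 + (nome r : ℂ) ^ (2 * m + 1) * Complex.exp (-(2 * phase r u)) ≠ 0) :
    AnalyticAt ℂ (cd₁Continuation r) u := by
  have hp := analyticAt_phase r u
  have h3 : AnalyticAt ℂ (fun u => poleSeries (nome r) (Complex.exp (2 * phase r u))) u :=
    (analyticAt_poleSeries (nome_pos r) (nome_lt_one hr) h1).comp
      (f := fun u => Complex.exp (2 * phase r u)) (by fun_prop)
  have h4 : AnalyticAt ℂ (fun u => poleSeries (nome r) (Complex.exp (-(2 * phase r u)))) u :=
    (analyticAt_poleSeries (nome_pos r) (nome_lt_one hr) h2).comp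
      (f := fun u => Complex.exp (-(2 * phase r u))) (by fun_prop)
  unfold cd₁Continuation
  fun_prop

/-- In the strip `|Im u| < K'` the arguments `exp (± i π u / K)` of `poleSeries` lie in the disc of
radius `1 / q`. -/
theorem nome_mul_norm_exp_lt_one {r : ℝ} (hr : 0 < r) {u : ℂ} (hu : |u.im| < quarterPeriod' r) :
    nome r * ‖Complex.exp (2 * phase r u)‖ < 1 ∧
      nome r * ‖Complex.exp (-(2 * phase r u))‖ < 1 := by
  have hK := quarterPeriod_pos hr
  have hre : (2 * phase r u).re = -(π / quarterPeriod r * u.im) := by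
    rw [show 2 * phase r u = (π / quarterPeriod r : ℝ) * (Complex.I * u) by
      rw [phase]; push_cast; field_simp, Complex.re_ofReal_mul, Complex.I_mul_re]
    ring
  have habs : |π / quarterPeriod r * u.im| < π * √r := by
    rw [abs_mul, abs_of_pos (by positivity)]
    calc π / quarterPeriod r * |u.im| < π / quarterPeriod r * quarterPeriod' r := by gcongr
      _ = π * √r := by rw [quarterPeriod'_eq hr]; field_simp
  obtain ⟨h1, h2⟩ := abs_lt.1 habs
  rw [Complex.norm_exp, Complex.norm_exp, Complex.neg_re, hre, nome, ← Real.exp_add,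
    ← Real.exp_add, Real.exp_lt_one_iff, Real.exp_lt_one_iff]
  exact ⟨by linarith, by linarith⟩

theorem hasSum_cd₁Term {r : ℝ} (hr : 0 < r) {u : ℂ} (hu : |u.im| < quarterPeriod' r) :
    HasSum (cd₁Term r u) (cd₁Continuation r u) := by
  obtain ⟨h1, h2⟩ := nome_mul_norm_exp_lt_one hr hu
  have s1 := (hasSum_poleSeries (nome_pos r) (nome_lt_one hr) h1).mul_left
    (Complex.exp (3 * phase r u))
  have s2 := (hasSum_poleSeries (nome_pos r) (nome_lt_one hr) h2).mul_left
    (Complex.exp (-(3 * phase r u)))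
  refine (((s1.add s2).mul_left ((√(nome r) : ℝ) / 2 : ℂ)).mul_left _).congr_fun fun n => ?_
  have hp : nome r ^ ((n : ℝ) + 1 / 2) = nome r ^ n * √(nome r) := by
    rw [Real.rpow_add (nome_pos r), Real.rpow_natCast, Real.sqrt_eq_rpow]
  have hc : Complex.cos ((2 * n + 3) * (π / (2 * quarterPeriod r)) * u) =
      (Complex.exp (3 * phase r u) * Complex.exp (2 * phase r u) ^ n +
        Complex.exp (-(3 * phase r u)) * Complex.exp (-(2 * phase r u)) ^ n) / 2 := by
    rw [← Complex.exp_nat_mul, ← Complex.exp_nat_mul, ← Complex.exp_add, ← Complex.exp_add,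
      Complex.cos]
    congr 3 <;> rw [phase] <;> ring
  rw [cd₁Term, hp, hc]
  push_cast
  ring

theorem isCd₁_toMeromorphicNFOn {r : ℝ} (hr : 0 < r) :
    IsCd₁ r (toMeromorphicNFOn (cd₁Continuation r) Set.univ) := by
  refine ⟨meromorphicNFOn_toMeromorphicNFOn _ _, fun u hu => ?_⟩
  obtain ⟨h1, h2⟩ := nome_mul_norm_exp_lt_one hr hu
  have ha := analyticAt_cd₁Continuation hr
    (one_add_pow_mul_ne_zero (nome_pos r) (nome_lt_one hr) h1)
    (one_add_pow_mul_ne_zero (nome_pos r) (nome_lt_one hr) h2)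
  rw [(toMeromorphicNFOn_eventuallyEq (meromorphicOn_cd₁Continuation hr) ha).eq_of_nhds]
  exact hasSum_cd₁Term hr hu

theorem IsCd₁.unique {r : ℝ} (hr : 0 < r) {F G : ℂ → ℂ} (hF : IsCd₁ r F) (hG : IsCd₁ r G) :
    F = G := by
  refine hF.1.eq_of_eventuallyEq hG.1 (z₀ := 0) ?_
  have hpos : 0 < quarterPeriod' r := by
    rw [quarterPeriod'_eq hr]
    exact mul_pos (Real.sqrt_pos.2 hr) (quarterPeriod_pos hr)
  have hopen : ∀ᶠ u : ℂ in nhds 0, |u.im| < quarterPeriod' r :=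
    Complex.continuous_im.abs.continuousAt.eventually_lt_const (by simpa using hpos)
  filter_upwards [hopen] with u hu
  exact (hF.2 u hu).unique (hG.2 u hu)

/-! ### The value at `i K'` -/

theorem phase_I_mul_quarterPeriod' {r : ℝ} (hr : 0 < r) :
    phase r (Complex.I * quarterPeriod' r) = (-(π * √r) / 2 : ℝ) := by
  have hK : (quarterPeriod r : ℂ) ≠ 0 := by exact_mod_cast (quarterPeriod_pos hr).ne'
  rw [phase, quarterPeriod'_eq hr]
  push_cast
  field_simp
  rw [Complex.I_sq]
  ring

theorem exp_two_phase {r : ℝ} (hr : 0 < r) :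
    Complex.exp (2 * phase r (Complex.I * quarterPeriod' r)) = (nome r : ℝ) := by
  rw [phase_I_mul_quarterPeriod' hr, nome, Complex.ofReal_exp]
  push_cast
  ring_nf

theorem exp_neg_two_phase {r : ℝ} (hr : 0 < r) :
    Complex.exp (-(2 * phase r (Complex.I * quarterPeriod' r))) = ((nome r)⁻¹ : ℝ) := by
  rw [Complex.exp_neg, exp_two_phase hr, Complex.ofReal_inv]

theorem sqrt_nome_mul_exp_three_phase {r : ℝ} (hr : 0 < r) :
    (√(nome r) : ℝ) * Complex.exp (3 * phase r (Complex.I * quarterPeriod' r)) =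
      (nome r ^ 2 : ℝ) := by
  rw [phase_I_mul_quarterPeriod' hr, nome, ← Real.exp_half, ← Real.exp_nat_mul,
    show (3 : ℂ) * ((-(π * √r) / 2 : ℝ) : ℂ) = ((3 * (-(π * √r) / 2) : ℝ) : ℂ) by push_cast; ring,
    ← Complex.ofReal_exp, ← Complex.ofReal_mul, ← Real.exp_add]
  congr 2
  push_cast
  ring

theorem sqrt_nome_mul_exp_neg_three_phase {r : ℝ} (hr : 0 < r) :
    (√(nome r) : ℝ) * Complex.exp (-(3 * phase r (Complex.I * quarterPeriod' r))) =
      ((nome r)⁻¹ : ℝ) := by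
  rw [phase_I_mul_quarterPeriod' hr, nome, ← Real.exp_half, ← Real.exp_neg,
    show -((3 : ℂ) * ((-(π * √r) / 2 : ℝ) : ℂ)) = ((-(3 * (-(π * √r) / 2)) : ℝ) : ℂ) by
      push_cast; ring,
    ← Complex.ofReal_exp, ← Complex.ofReal_mul, ← Real.exp_add]
  congr 2
  ring

theorem inv_cosh_eq_nome (r : ℝ) (m : ℕ) :
    (Real.cosh (π * √r * m))⁻¹ = 2 * (nome r ^ m / (1 + nome r ^ (2 * m))) := by
  have h := one_add_exp_mul_inv_cosh (π * √r * m)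
  have e1 : Real.exp (-(2 * (π * √r * m))) = nome r ^ (2 * m) := by
    rw [nome, ← Real.exp_nat_mul]
    push_cast
    ring_nf
  have e2 : Real.exp (-(π * √r * m)) = nome r ^ m := by
    rw [nome, ← Real.exp_nat_mul]
    ring_nf
  have hpos : 0 < 1 + nome r ^ (2 * m) := by have := nome_pos r; positivity
  rw [e1, e2] at h
  rw [← mul_div_assoc, eq_div_iff hpos.ne', ← h, mul_comm]

theorem poleSeries_nome_inv {r : ℝ} (hr : 0 < r) :
    poleSeries (nome r) ((nome r)⁻¹ : ℝ) = ((theta3 √r ^ 2 + 1) / 4 : ℝ) ∧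
      poleSeries (nome r) (nome r) = ((theta3 √r ^ 2 - 1) / (4 * nome r) : ℝ) := by
  have hs : 0 < √r := Real.sqrt_pos.2 hr
  have hq := nome_pos r
  have hc := summable_inv_cosh hs
  have hN : Summable fun m : ℕ => (Real.cosh (π * √r * m))⁻¹ := by
    simpa [Function.comp_def] using hc.comp_injective Nat.cast_injective
  have hneg : ∀ m : ℕ, (Real.cosh (π * √r * ((-(m + 1) : ℤ) : ℝ)))⁻¹ =
      (Real.cosh (π * √r * (m + 1 : ℕ)))⁻¹ := fun m => by
    rw [← Real.cosh_neg]
    push_cast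
    ring_nf
  have hN1 := (summable_nat_add_iff 1).2 hN
  have e1 := tsum_of_nat_of_neg_add_one (f := fun n : ℤ => (Real.cosh (π * √r * n))⁻¹)
    (by simpa using hN) (hN1.congr fun m => (hneg m).symm)
  have e2 := hN.tsum_eq_zero_add
  have e3 := sechSum_eq hs
  rw [sechSum] at e3
  simp only [hneg, Int.cast_natCast] at e1
  simp only [Nat.cast_zero, mul_zero, Real.cosh_zero, inv_one] at e2
  rw [e3] at e1
  constructor
  · have e4 : poleSeries (nome r) ((nome r)⁻¹ : ℝ) =
        ((∑' m : ℕ, (Real.cosh (π * √r * m))⁻¹) / 2 : ℝ) := by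
      rw [← tsum_div_const, Complex.ofReal_tsum, poleSeries]
      refine tsum_congr fun m => ?_
      rw [inv_cosh_eq_nome, mul_div_cancel_left₀ _ two_ne_zero]
      have : (nome r : ℂ) ≠ 0 := by exact_mod_cast hq.ne'
      push_cast
      rw [pow_succ, mul_assoc, mul_inv_cancel₀ this, mul_one]
    rw [e4]
    congr 1
    linarith
  · have e4 : poleSeries (nome r) (nome r) =
        ((∑' m : ℕ, (Real.cosh (π * √r * (m + 1 : ℕ)))⁻¹) / (2 * nome r) : ℝ) := by
      rw [← tsum_div_const, Complex.ofReal_tsum, poleSeries]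
      refine tsum_congr fun m => ?_
      rw [inv_cosh_eq_nome, mul_div_mul_left _ _ two_ne_zero, div_right_comm, pow_succ (nome r) m,
        mul_div_cancel_right₀ _ hq.ne']
      push_cast
      ring_nf
    rw [e4]
    congr 1
    have e5 : ∑' m : ℕ, (Real.cosh (π * √r * (m + 1 : ℕ)))⁻¹ = (theta3 √r ^ 2 - 1) / 2 := by
      linarith
    rw [e5]
    field_simp
    ring

theorem cd₁Continuation_I_mul_quarterPeriod' {r : ℝ} (hr : 0 < r) :
    cd₁Continuation r (Complex.I * quarterPeriod' r) =
      ((1 / (nome r * singularModulus r) - Real.sinh (π * √r) / singularModulus r *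
        (1 - π / (2 * quarterPeriod r)) : ℝ) : ℂ) := by
  have hq := nome_pos r
  have h3 := theta3_pos (Real.sqrt_pos.2 hr)
  have hk := (singularModulus_spec hr).1.1
  obtain ⟨e1, e2⟩ := poleSeries_nome_inv hr
  have hsinh : Real.sinh (π * √r) = ((nome r)⁻¹ - nome r) / 2 := by
    rw [Real.sinh_eq, nome, ← Real.exp_neg, neg_neg]
  rw [cd₁Continuation, exp_two_phase hr, exp_neg_two_phase hr, e1, e2, div_mul_eq_mul_div, mul_add,
    ← mul_assoc (Complex.ofReal √(nome r)), ← mul_assoc (Complex.ofReal √(nome r)),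
    sqrt_nome_mul_exp_three_phase hr, sqrt_nome_mul_exp_neg_three_phase hr, hsinh,
    quarterPeriod_eq hr]
  norm_cast
  have := Real.pi_pos
  field_simp
  ring

theorem analyticAt_cd₁Continuation_I_mul_quarterPeriod' {r : ℝ} (hr : 0 < r) :
    AnalyticAt ℂ (cd₁Continuation r) (Complex.I * quarterPeriod' r) := by
  have hq := nome_pos r
  have hne : ∀ (m : ℕ) {x : ℝ}, 0 < x → 1 + (nome r : ℂ) ^ (2 * m + 1) * (x : ℂ) ≠ 0 :=
    fun m x hx => by
      have : 0 < 1 + nome r ^ (2 * m + 1) * x := by positivity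
      exact_mod_cast this.ne'
  refine analyticAt_cd₁Continuation hr (fun m => ?_) fun m => ?_
  · rw [exp_two_phase hr]
    exact hne m hq
  · rw [exp_neg_two_phase hr]
    exact hne m (inv_pos.2 hq)

theorem theorem12 (r : ℝ) (hr : 0 < r) :
    (∃! F : ℂ → ℂ, IsCd₁ r F) ∧
    ∀ F : ℂ → ℂ, IsCd₁ r F →
      AnalyticAt ℂ F (Complex.I * (quarterPeriod' r : ℂ)) ∧
      F (Complex.I * (quarterPeriod' r : ℂ)) =
        ((1 / (nome r * singularModulus r) -
          Real.sinh (Real.pi * √r) / singularModulus r *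
            (1 - Real.pi / (2 * quarterPeriod r)) : ℝ) : ℂ) := by
  have hex := isCd₁_toMeromorphicNFOn hr
  refine ⟨⟨_, hex, fun G hG => hG.unique hr hex⟩, fun F hF => ?_⟩
  have ha := analyticAt_cd₁Continuation_I_mul_quarterPeriod' hr
  have he := toMeromorphicNFOn_eventuallyEq (meromorphicOn_cd₁Continuation hr) ha
  rw [hF.unique hr hex]
  exact ⟨ha.congr he.symm, he.eq_of_nhds.trans (cd₁Continuation_I_mul_quarterPeriod' hr)⟩
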